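/- For integers $p \ge 2$ and $n\ge 1$ let $J=(J_{i_1,\dots,i_p})_{1\le i_1,\dots,i_p\le n}$ have i.i.d. standard normal entries, and for $\sigma\in\Sigma_n=\{-1,1\}^n$ let $$H(\sigma)=n^{-\frac{p+1}{2}}\sum_{1\le i_1,\dots,i_p\le n}J_{i_1,\dots,i_p}\sigma_{i_1}\cdots\sigma_{i_p}.$$ Put $$Z_\beta=\sum_{\sigma\in\Sigma_n}e^{\beta nH(\sigma)},\qquad Z_\beta[\kappa_1,\kappa_2]=\sum_{\sigma\in\Sigma_n:\ \kappa_1\sqrt{2\ln 2}\le H(\sigma)\le\kappa_2\sqrt{2\ln 2}}e^{\beta nH(\sigma)},\qquad \mu_\beta(A)=\frac1{Z_\beta}\sum_{\sigma\in A}e^{\beta nH(\sigma)}\quad(A\subseteq\Sigma_n).$$ **Proposition.** For every $0<\beta<\sqrt{2\ln 2}$ and $0<\kappa<1/\sqrt2$ there is a $P^*\in\mathbb N$ such that for every fixed $p\ge P^*$ there are constants $0<c\le C$ for which, with probability tending to $1$ as $n\to\infty$, both of the following hold. 1. $Z_\beta=Z_\beta\left[\frac{\beta}{\sqrt{2\ln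 2}}-\kappa,\ \frac{\beta}{\sqrt{2\ln 2}}+\kappa\right](1+e^{-x})$ for some (random) $x\in[cn,Cn]$. 2. $\mu_\beta\left(\left\{\sigma\in\Sigma_n:\frac{H(\sigma)}{\sqrt{2\ln 2}}\in\left[\frac{\beta}{\sqrt{2\ln 2}}-\kappa,\ \frac{\beta}{\sqrt{2\ln 2}}+\kappa\right]\right\}\right)=1-e^{-y}$ for some (random) $y\in[cn,Cn]$. That is, $Z_\beta=Z_\beta\left[\frac{\beta}{\sqrt{2\ln 2}}\pm\kappa\right](1+e^{-\Theta(n)})$, and the energy band carries Gibbs mass $1-e^{-\Theta(n)}$. -/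

import Mathlib

open MeasureTheory ProbabilityTheory Filter Topology

namespace PSpin

/-- An order-`p` tensor in `(ℝⁿ)^{⊗p}`, given by its entries `J_{i₁,…,i_p}`. -/
abbrev Tensor (n p : ℕ) : Type := (Fin p → Fin n) → ℝ

/-- The law of a tensor whose entries are i.i.d. standard normal. -/
noncomputable def disorder (n p : ℕ) : Measure (Tensor n p) :=
  Measure.pi fun _ => gaussianReal 0 1

/-- The discrete hypercube `{-1, 1}ⁿ`. -/
noncomputable def hypercube (n : ℕ) : Finset (Fin n → ℝ) :=
  Fintype.piFinset fun _ => {-1, 1}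

/-- The pure `p`-spin Hamiltonian
`H(σ) = n^{-(p+1)/2} ∑_{i₁,…,i_p} J_{i₁,…,i_p} σ_{i₁} ⋯ σ_{i_p}`. -/
noncomputable def hamiltonian {n p : ℕ} (J : Tensor n p) (σ : Fin n → ℝ) : ℝ :=
  (n : ℝ) ^ (-((p : ℝ) + 1) / 2) * ∑ i : Fin p → Fin n, J i * ∏ k, σ (i k)

/-- The contribution `∑_{σ ∈ Σₙ ∩ A} e^{β n H(σ)}` of a set `A` of configurations. -/
noncomputable def weight {n p : ℕ} (β : ℝ) (J : Tensor n p) (A : Set (Fin n → ℝ)) : ℝ :=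
  open Classical in
  ∑ σ ∈ hypercube n with σ ∈ A, Real.exp (β * n * hamiltonian J σ)

/-- The partition function `Z_β = ∑_{σ ∈ Σₙ} e^{β n H(σ)}`. -/
noncomputable def partition {n p : ℕ} (β : ℝ) (J : Tensor n p) : ℝ :=
  ∑ σ ∈ hypercube n, Real.exp (β * n * hamiltonian J σ)

/-- The restricted partition function `Z_β[κ₁, κ₂]`, the sum over the `σ ∈ Σₙ` with
`κ₁ √(2 ln 2) ≤ H(σ) ≤ κ₂ √(2 ln 2)`. -/
noncomputable def restrictedPartition {n p : ℕ} (β : ℝ) (J : Tensor n p) (κ₁ κ₂ : ℝ) : ℝ :=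
  weight β J {σ | κ₁ * √(2 * Real.log 2) ≤ hamiltonian J σ ∧
    hamiltonian J σ ≤ κ₂ * √(2 * Real.log 2)}

/-- The Gibbs mass `μ_β(A) = Z_β⁻¹ ∑_{σ ∈ Σₙ ∩ A} e^{β n H(σ)}`. -/
noncomputable def gibbs {n p : ℕ} (β : ℝ) (J : Tensor n p) (A : Set (Fin n → ℝ)) : ℝ :=
  weight β J A / partition β J

end PSpin

/-! For `σ` in the hypercube, `√n * hamiltonian J σ` is standard normal, and two such variables have
correlation equal to the `p`-th power of the overlap of the configurations. Hence Z_t has mean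
exp((log 2 + t²/2) n) for every real t, and Markov's inequality bounds Z_t above at this rate,
whatever t is.

Let d = κ√(2 log 2), so that the band is [β - d, β + d]. Exponential tilting (`weight_le_of_forall`)
bounds the weight outside it by multiples of Z_{β+d} and Z_{β-d}. Completing the square gives both
bounds the rate log 2 + β²/2 - d²/2, which is d²/2 less than the annealed rate of Z_β.

It remains to see that Z_β nearly attains its annealed rate, and that the outside weight is not
smaller than exponentially small. The first follows from many configurations with energy just above
β, the second from a single one with energy near -√(log 2). The condition κ < 1/√2 says d < √(log
2), which puts that energy below the band.

Both existence claims come from a second moment argument (`exists_tendsto_card_lt`) at energies at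
most b in absolute value, where b²/2 < log 2. The pair probabilities are compared with independent
ones through `densityRatio`, averaged over overlaps (`exists_sum_densityRatio_le`). Small overlaps
give a ratio near 1. At intermediate overlaps a large `p` makes the correlation so small that
entropy wins. Near ±1 the ratio is about exp(b²n/2), and there are few enough such pairs because
b²/2 < log 2. -/

namespace PSpin

/-! ### Linear functionals of an i.i.d. Gaussian vector -/

section GaussianLinear

variable {ι : Type*} [Fintype ι]

lemma hasGaussianLaw_id_pi_gaussianReal :
    HasGaussianLaw (fun J : ι → ℝ => (fun i => J i)) (Measure.pi fun _ => gaussianReal 0 1) := by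
  refine iIndepFun.hasGaussianLaw (X := fun i (J : ι → ℝ) => J i) (fun i => ?_) ?_
  · have : HasLaw (fun J : ι → ℝ => J i) (gaussianReal 0 1)
        (Measure.pi fun _ : ι => gaussianReal 0 1) :=
      (measurePreserving_eval (fun _ : ι => gaussianReal 0 1) i).hasLaw
    exact this.hasGaussianLaw
  · exact iIndepFun_pi (X := fun _ x => x) (fun _ => by fun_prop)

lemma covariance_eval_pi_gaussianReal [DecidableEq ι] (i j : ι) :
    cov[fun J : ι → ℝ => J i, fun J : ι → ℝ => J j; Measure.pi fun _ => gaussianReal 0 1] =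
      if i = j then 1 else 0 := by
  have hl : ∀ i, HasLaw (fun J : ι → ℝ => J i) (gaussianReal 0 1)
      (Measure.pi fun _ : ι => gaussianReal 0 1) := fun i =>
    (measurePreserving_eval (fun _ : ι => gaussianReal 0 1) i).hasLaw
  split_ifs with h
  · subst h
    rw [covariance_self (by fun_prop : Measurable _).aemeasurable, (hl i).variance_eq]
    simp
  · have hi : iIndepFun (fun i (J : ι → ℝ) => J i) (Measure.pi fun _ => gaussianReal 0 1) :=
      iIndepFun_pi (X := fun _ x => x) (fun _ => by fun_prop)
    exact (hi.indepFun h).covariance_eq_zero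
      ((hl i).hasGaussianLaw.memLp_two) ((hl j).hasGaussianLaw.memLp_two)

lemma memLp_eval_pi_gaussianReal (i : ι) :
    MemLp (fun J : ι → ℝ => J i) 2 (Measure.pi fun _ => gaussianReal 0 1) :=
  (hasGaussianLaw_id_pi_gaussianReal.eval (X := fun i (J : ι → ℝ) => J i) i).memLp_two

lemma covariance_linear_pi_gaussianReal (a b : ι → ℝ) :
    cov[fun J : ι → ℝ => ∑ i, J i * a i, fun J : ι → ℝ => ∑ i, J i * b i;
      Measure.pi fun _ => gaussianReal 0 1] = ∑ i, a i * b i := by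
  classical
  rw [covariance_fun_sum_fun_sum (fun i => (memLp_eval_pi_gaussianReal i).mul_const _)
    (fun i => (memLp_eval_pi_gaussianReal i).mul_const _)]
  simp_rw [covariance_mul_const_left, covariance_mul_const_right, covariance_eval_pi_gaussianReal]
  simp [mul_comm]

lemma hasGaussianLaw_linear_pair (a b : ι → ℝ) :
    HasGaussianLaw (fun J : ι → ℝ => (∑ i, J i * a i, ∑ i, J i * b i))
      (Measure.pi fun _ => gaussianReal 0 1) := by
  have h := hasGaussianLaw_id_pi_gaussianReal (ι := ι) |>.map_fun
    ((∑ i, a i • ContinuousLinearMap.proj (R := ℝ) (φ := fun _ : ι => ℝ) i).prod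
     (∑ i, b i • ContinuousLinearMap.proj (R := ℝ) (φ := fun _ : ι => ℝ) i))
  simpa [mul_comm] using h

lemma map_linear_pi_gaussianReal (a : ι → ℝ) :
    (Measure.pi fun _ : ι => gaussianReal 0 1).map (fun J => ∑ i, J i * a i) =
      gaussianReal 0 (∑ i, a i ^ 2).toNNReal := by
  rw [(hasGaussianLaw_linear_pair a a).fst.map_eq_gaussianReal]
  congr 2
  · rw [integral_finsetSum]
    · refine Finset.sum_eq_zero fun i _ => ?_
      rw [integral_mul_const]
      have hl : HasLaw (fun J : ι → ℝ => J i) (gaussianReal 0 1)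
          (Measure.pi fun _ : ι => gaussianReal 0 1) :=
        (measurePreserving_eval (fun _ : ι => gaussianReal 0 1) i).hasLaw
      rw [hl.integral_eq]
      simp
    · intro i _
      exact ((memLp_eval_pi_gaussianReal i).integrable (by norm_num)).mul_const _
  · rw [← covariance_self (by fun_prop : Measurable _).aemeasurable, covariance_linear_pi_gaussianReal]
    simp [pow_two]

lemma indepFun_linear_pi_gaussianReal (a b : ι → ℝ) (h : ∑ i, a i * b i = 0) :
    IndepFun (fun J : ι → ℝ => ∑ i, J i * a i) (fun J => ∑ i, J i * b i)
      (Measure.pi fun _ => gaussianReal 0 1) :=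
  (hasGaussianLaw_linear_pair a b).indepFun_of_covariance_eq_zero
    (by rw [covariance_linear_pi_gaussianReal, h])

end GaussianLinear

/-! ### Comparison of correlated and independent Gaussian pairs -/

/-- A bound for the ratio of the joint density of two standard normal variables with correlation
`r` to the product density, on the square `[-B, B]²`. -/
noncomputable def densityRatio (B r : ℝ) : ℝ :=
  (√(1 - r ^ 2))⁻¹ * Real.exp (B ^ 2 * |r| / (1 + |r|))

lemma densityRatio_nonneg (B r : ℝ) : 0 ≤ densityRatio B r := by
  unfold densityRatio; positivity

lemma gaussianPDFReal_le_densityRatio_mul {B r x y : ℝ} (hr : |r| < 1) (hx : |x| ≤ B)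
    (hy : |y| ≤ B) :
    gaussianPDFReal (r * x) (1 - r ^ 2).toNNReal y ≤ densityRatio B r * gaussianPDFReal 0 1 y := by
  have hr2 : 0 < 1 - r ^ 2 := by
    have := (sq_lt_one_iff_abs_lt_one r).2 hr
    linarith
  have h1r : 0 < 1 - |r| := by linarith
  have h1r' : 0 < 1 + |r| := by linarith [abs_nonneg r]
  have hfac : 1 - r ^ 2 = (1 - |r|) * (1 + |r|) := by rw [← sq_abs r]; ring
  unfold gaussianPDFReal densityRatio
  rw [Real.coe_toNNReal _ hr2.le, Real.sqrt_mul (by positivity), mul_inv]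
  -- The numerator is maximal for x and y equal in size to B, and 1 - |r| then cancels from 1 - r².
  -- So the exponent stays below B²/2 even as |r| tends to 1, which is what the second moment needs
  -- near overlap ±1.
  have key : -(y - r * x) ^ 2 / (2 * (1 - r ^ 2)) ≤
      B ^ 2 * |r| / (1 + |r|) + -(y - 0) ^ 2 / (2 * ((1 : NNReal) : ℝ)) := by
    have e : -(y - r * x) ^ 2 / (2 * (1 - r ^ 2)) =
      (2 * (r * (x * y)) - r ^ 2 * (x ^ 2 + y ^ 2)) / (2 * (1 - r ^ 2)) + -(y - 0) ^ 2 / 2 := by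
      field_simp
      ring
    rw [e]
    have : (2 * (r * (x * y)) - r ^ 2 * (x ^ 2 + y ^ 2)) / (2 * (1 - r ^ 2)) ≤
        B ^ 2 * |r| / (1 + |r|) := by
      rw [hfac, div_le_div_iff₀ (by positivity) h1r']
      have h1 : r * (x * y) ≤ |r| * (|x| * |y|) := by
        rw [← abs_mul, ← abs_mul]; exact le_abs_self _
      have h2 : |x| * |y| ≤ B ^ 2 := by
        rw [pow_two]; exact mul_le_mul hx hy (abs_nonneg _) ((abs_nonneg _).trans hx)
      have h3 : 2 * (r * (x * y)) - r ^ 2 * (x ^ 2 + y ^ 2) ≤ 2 * (1 - |r|) * |r| * B ^ 2 := by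
        rw [← sq_abs r, ← sq_abs x, ← sq_abs y]
        have := mul_le_mul_of_nonneg_left h2 (mul_nonneg h1r.le (abs_nonneg r))
        nlinarith [mul_nonneg (sq_nonneg |r|) (sq_nonneg (|x| - |y|))]
      calc _ ≤ 2 * (1 - |r|) * |r| * B ^ 2 * (1 + |r|) := by gcongr
        _ = _ := by ring
    simpa using this
  calc _ ≤ (√(2 * Real.pi))⁻¹ * (√(1 - r ^ 2))⁻¹ *
      Real.exp (B ^ 2 * |r| / (1 + |r|) + -(y - 0) ^ 2 / (2 * ((1 : NNReal) : ℝ))) := by gcongr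
    _ = _ := by rw [Real.exp_add]; simp; ring

lemma gaussianReal_le_densityRatio_mul {B r x : ℝ} (hr : |r| < 1) (hx : |x| ≤ B) {A : Set ℝ}
    (hA : MeasurableSet A) (hAB : ∀ y ∈ A, |y| ≤ B) :
    gaussianReal (r * x) (1 - r ^ 2).toNNReal A ≤
      ENNReal.ofReal (densityRatio B r) * gaussianReal 0 1 A := by
  have hr2 : 0 < 1 - r ^ 2 := by
    have := (sq_lt_one_iff_abs_lt_one r).2 hr
    linarith
  rw [gaussianReal_apply _ (by simpa using hr2), gaussianReal_apply _ one_ne_zero,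
    ← lintegral_const_mul _ (by fun_prop)]
  refine setLIntegral_mono' hA fun y hy => ?_
  rw [gaussianPDF, gaussianPDF, ← ENNReal.ofReal_mul (densityRatio_nonneg _ _)]
  exact ENNReal.ofReal_le_ofReal (gaussianPDFReal_le_densityRatio_mul hr hx (hAB y hy))

/-- Two correlated standard normal variables lie simultaneously in a subset of `[-B, B]` with at
most `densityRatio B r` times the probability for independent ones. -/
lemma measure_linear_pair_le {ι : Type*} [Fintype ι] {a b : ι → ℝ} {r B : ℝ}
    (ha : ∑ i, a i ^ 2 = 1) (hb : ∑ i, b i ^ 2 = 1) (hab : ∑ i, a i * b i = r) (hr : |r| < 1)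
    {A : Set ℝ} (hA : MeasurableSet A) (hAB : ∀ y ∈ A, |y| ≤ B) :
    (Measure.pi fun _ : ι => gaussianReal 0 1)
        {J | ∑ i, J i * a i ∈ A ∧ ∑ i, J i * b i ∈ A} ≤
      ENNReal.ofReal (densityRatio B r) * (gaussianReal 0 1 A) ^ 2 := by
  set μ : Measure (ι → ℝ) := Measure.pi fun _ : ι => gaussianReal 0 1
  -- Gram–Schmidt: b = r a + c with c orthogonal to a, so the second functional is r times the first
  -- plus independent noise of variance 1 - r².
  set c : ι → ℝ := fun i => b i - r * a i
  have hc : ∑ i, c i ^ 2 = 1 - r ^ 2 := by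
    have : ∀ i, c i ^ 2 = b i ^ 2 - 2 * r * (a i * b i) + r ^ 2 * a i ^ 2 := fun i => by
      simp only [c]; ring
    simp_rw [this, Finset.sum_add_distrib, Finset.sum_sub_distrib, ← Finset.mul_sum, ha, hb, hab]
    ring
  have hac : ∑ i, a i * c i = 0 := by
    have : ∀ i, a i * c i = a i * b i - r * a i ^ 2 := fun i => by simp only [c]; ring
    simp_rw [this, Finset.sum_sub_distrib, ← Finset.mul_sum, ha, hab]
    ring
  have hind := indepFun_linear_pi_gaussianReal a c hac
  have hmap : μ.map (fun J => (∑ i, J i * a i, ∑ i, J i * c i)) =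
      (gaussianReal 0 1).prod (gaussianReal 0 (1 - r ^ 2).toNNReal) := by
    rw [(indepFun_iff_map_prod_eq_prod_map_map
        (by fun_prop : Measurable _).aemeasurable (by fun_prop : Measurable _).aemeasurable).1 hind,
      map_linear_pi_gaussianReal, map_linear_pi_gaussianReal, ha, hc, Real.toNNReal_one]
  set S : Set (ℝ × ℝ) := {q | q.1 ∈ A ∧ r * q.1 + q.2 ∈ A}
  have hS : MeasurableSet S :=
    (measurable_fst hA).inter ((by fun_prop : Measurable fun q : ℝ × ℝ => r * q.1 + q.2) hA)
  have hset : {J : ι → ℝ | ∑ i, J i * a i ∈ A ∧ ∑ i, J i * b i ∈ A} =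
      (fun J => (∑ i, J i * a i, ∑ i, J i * c i)) ⁻¹' S := by
    ext J
    have : r * ∑ i, J i * a i + ∑ i, J i * c i = ∑ i, J i * b i := by
      rw [Finset.mul_sum, ← Finset.sum_add_distrib]
      exact Finset.sum_congr rfl fun i _ => by simp only [c]; ring
    simp [S, this]
  rw [hset, ← Measure.map_apply (by fun_prop) hS, hmap, Measure.prod_apply hS]
  calc ∫⁻ x, gaussianReal 0 (1 - r ^ 2).toNNReal (Prod.mk x ⁻¹' S) ∂gaussianReal 0 1
      ≤ ∫⁻ x, A.indicator
          (fun _ => ENNReal.ofReal (densityRatio B r) * gaussianReal 0 1 A) x ∂gaussianReal 0 1 := by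
        refine lintegral_mono fun x => ?_
        by_cases hx : x ∈ A
        · rw [Set.indicator_of_mem hx]
          have : Prod.mk x ⁻¹' S = (fun y => r * x + y) ⁻¹' A := by ext y; simp [S, hx]
          rw [this, ← Measure.map_apply (by fun_prop) hA, gaussianReal_map_const_add, zero_add]
          exact gaussianReal_le_densityRatio_mul hr (hAB x hx) hA hAB
        · have : Prod.mk x ⁻¹' S = ∅ := by ext y; simp [S, hx]
          rw [this]; simp
    _ = _ := by rw [lintegral_indicator_const hA, pow_two, mul_assoc]

/-! ### Counting configurations by magnetization -/

section Hypercube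

variable {n : ℕ}

lemma mem_hypercube {σ : Fin n → ℝ} : σ ∈ hypercube n ↔ ∀ j, σ j = -1 ∨ σ j = 1 := by
  simp [hypercube]

lemma card_hypercube : (hypercube n).card = 2 ^ n := by
  rw [hypercube, Fintype.card_piFinset_const, Finset.card_pair (by norm_num)]

lemma sq_apply_of_mem_hypercube {σ : Fin n → ℝ} (hσ : σ ∈ hypercube n) (j : Fin n) :
    σ j * σ j = 1 := by
  rcases mem_hypercube.1 hσ j with h | h <;> simp [h]

lemma mul_mem_hypercube {σ τ : Fin n → ℝ} (hσ : σ ∈ hypercube n) (hτ : τ ∈ hypercube n) :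
    σ * τ ∈ hypercube n := by
  refine mem_hypercube.2 fun j => ?_
  rcases mem_hypercube.1 hσ j with h | h <;> rcases mem_hypercube.1 hτ j with h' | h' <;>
    simp [h, h']

/-- Coordinatewise multiplication by σ is an involution of the hypercube. This turns a sum over
pairs that depends only on overlaps into a sum over one configuration. -/
lemma sum_hypercube_mul {M : Type*} [AddCommMonoid M] {σ : Fin n → ℝ} (hσ : σ ∈ hypercube n)
    (F : (Fin n → ℝ) → M) : ∑ τ ∈ hypercube n, F (σ * τ) = ∑ s ∈ hypercube n, F s := by
  have hinv : ∀ s : Fin n → ℝ, σ * (σ * s) = s := fun s => by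
    ext j; simp [← mul_assoc, sq_apply_of_mem_hypercube hσ j]
  exact Finset.sum_nbij' (fun τ => σ * τ) (fun s => σ * s)
    (fun τ hτ => mul_mem_hypercube hσ hτ) (fun s hs => mul_mem_hypercube hσ hs)
    (fun τ _ => hinv τ) (fun s _ => hinv s) (fun _ _ => rfl)

lemma sum_hypercube_exp (l : ℝ) :
    ∑ s ∈ hypercube n, Real.exp (l * ∑ j, s j) = (2 * Real.cosh l) ^ n := by
  simp_rw [Finset.mul_sum, Real.exp_sum]
  rw [hypercube, Finset.sum_prod_piFinset (g := fun _ x => Real.exp (l * x))]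
  simp only [Finset.prod_const, Finset.card_univ, Fintype.card_fin]
  rw [Finset.sum_pair (by norm_num), Real.cosh_eq]
  ring_nf

lemma exists_sum_eq_of_mem_hypercube {s : Fin n → ℝ} (hs : s ∈ hypercube n) :
    ∃ k ≤ n, ∑ j, s j = (n : ℝ) - 2 * k := by
  classical
  refine ⟨(Finset.univ.filter fun j => s j = -1).card,
    (Finset.card_le_univ _).trans_eq (by simp), ?_⟩
  have : ∀ j, s j = 1 - 2 * (if s j = -1 then 1 else 0) := fun j => by
    rcases mem_hypercube.1 hs j with h | h <;> rw [h] <;> norm_num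
  rw [Finset.sum_congr rfl fun j _ => this j, Finset.sum_sub_distrib, ← Finset.mul_sum]
  simp

lemma abs_sum_le_sub_one {s : Fin n → ℝ} (hs : s ∈ hypercube n) (h : |∑ j, s j| ≠ (n : ℝ)) :
    |∑ j, s j| ≤ n - 1 := by
  obtain ⟨k, hk, e⟩ := exists_sum_eq_of_mem_hypercube hs
  rw [e] at h ⊢
  have h0 : k ≠ 0 := by rintro rfl; simp at h
  have hn : k ≠ n := by
    rintro rfl
    apply h
    rw [show (k : ℝ) - 2 * k = -k by ring, abs_neg, abs_of_nonneg (by positivity)]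
  have h1 : (1 : ℝ) ≤ k := by exact_mod_cast Nat.one_le_iff_ne_zero.2 h0
  have h2 : (k : ℝ) + 1 ≤ n := by exact_mod_cast lt_of_le_of_ne hk hn
  rw [abs_le]
  constructor <;> linarith

/-- Chernoff bound at the parameter m / n, with cosh l ≤ exp(l²/2). -/
lemma card_sum_eq_le (m : ℝ) :
    (((hypercube n).filter fun s => ∑ j, s j = m).card : ℝ) ≤
      2 ^ n * Real.exp (-(m ^ 2 / (2 * n))) := by
  have h1 : (((hypercube n).filter fun s => ∑ j, s j = m).card : ℝ) * Real.exp (m / n * m) ≤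
      (2 * Real.cosh (m / n)) ^ n := by
    rw [← sum_hypercube_exp, ← nsmul_eq_mul, ← Finset.sum_const]
    refine (Finset.sum_le_sum fun s hs => ?_).trans
      (Finset.sum_le_sum_of_subset_of_nonneg (Finset.filter_subset _ _)
        fun _ _ _ => (Real.exp_pos _).le)
    rw [(Finset.mem_filter.1 hs).2]
  have h2 : (2 * Real.cosh (m / n)) ^ n ≤ 2 ^ n * Real.exp (m ^ 2 / (2 * n)) := by
    rw [mul_pow]
    gcongr
    calc Real.cosh (m / n) ^ n ≤ Real.exp ((m / n) ^ 2 / 2) ^ n := by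
          gcongr
          exact Real.cosh_le_exp_half_sq _
      _ = Real.exp (m ^ 2 / (2 * n)) := by
          rw [← Real.exp_nat_mul]
          congr 1
          rcases eq_or_ne (n : ℝ) 0 with h | h
          · simp [h]
          · field_simp
  have h3 : Real.exp (m / n * m) = Real.exp (m ^ 2 / (2 * n)) * Real.exp (m ^ 2 / (2 * n)) := by
    rw [← Real.exp_add]
    congr 1
    rcases eq_or_ne (n : ℝ) 0 with h | h
    · simp [h]
    · field_simp; ring
  have h4 := h1.trans h2
  rw [h3, ← mul_assoc] at h4
  rw [Real.exp_neg, ← div_eq_mul_inv, le_div_iff₀ (Real.exp_pos _)]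
  exact le_of_mul_le_mul_right h4 (Real.exp_pos _)

/-- Chernoff bound with 2 cosh l ≤ exp(l + exp(-2l)). Unlike the Gaussian bound it captures the
vanishing entropy near |overlap| = 1: take l large, then r close to 1. -/
lemma card_abs_sum_ge_le {l r : ℝ} (hl : 0 ≤ l) :
    (((hypercube n).filter fun s => r * n ≤ |∑ j, s j|).card : ℝ) ≤
      2 * Real.exp ((Real.exp (-2 * l) + l * (1 - r)) * n) := by
  have h1 : (((hypercube n).filter fun s => r * n ≤ |∑ j, s j|).card : ℝ) *
      Real.exp (l * (r * n)) ≤ 2 * (2 * Real.cosh l) ^ n := by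
    calc _ = ∑ s ∈ (hypercube n).filter fun s => r * n ≤ |∑ j, s j|, Real.exp (l * (r * n)) := by
          rw [Finset.sum_const, nsmul_eq_mul]
      _ ≤ ∑ s ∈ (hypercube n).filter fun s => r * n ≤ |∑ j, s j|,
            (Real.exp (l * ∑ j, s j) + Real.exp (-l * ∑ j, s j)) := by
          refine Finset.sum_le_sum fun s hs => ?_
          have h := (Finset.mem_filter.1 hs).2
          rcases le_abs.1 h with h | h
          · have : Real.exp (l * (r * n)) ≤ Real.exp (l * ∑ j, s j) := by gcongr
            linarith [Real.exp_pos (-l * ∑ j, s j)]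
          · have : Real.exp (l * (r * n)) ≤ Real.exp (-l * ∑ j, s j) := by
              rw [neg_mul, ← mul_neg]; gcongr
            linarith [Real.exp_pos (l * ∑ j, s j)]
      _ ≤ ∑ s ∈ hypercube n, (Real.exp (l * ∑ j, s j) + Real.exp (-l * ∑ j, s j)) :=
          Finset.sum_le_sum_of_subset_of_nonneg (Finset.filter_subset _ _)
            fun _ _ _ => by positivity
      _ = _ := by
          rw [Finset.sum_add_distrib, sum_hypercube_exp, sum_hypercube_exp, Real.cosh_neg]
          ring
  have h2 : 2 * Real.cosh l ≤ Real.exp (l + Real.exp (-2 * l)) := by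
    rw [Real.exp_add, Real.cosh_eq]
    have h3 : Real.exp (-l) = Real.exp l * Real.exp (-2 * l) := by
      rw [← Real.exp_add]; ring_nf
    have h4 := Real.add_one_le_exp (Real.exp (-2 * l))
    nlinarith [Real.exp_pos l]
  have h5 : (2 * Real.cosh l) ^ n ≤ Real.exp ((l + Real.exp (-2 * l)) * n) := by
    rw [mul_comm _ (n : ℝ), Real.exp_nat_mul]
    exact pow_le_pow_left₀ (by linarith [Real.cosh_pos l]) h2 n
  have h6 : Real.exp ((l + Real.exp (-2 * l)) * n) =
      Real.exp ((Real.exp (-2 * l) + l * (1 - r)) * n) * Real.exp (l * (r * n)) := by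
    rw [← Real.exp_add]; ring_nf
  refine le_of_mul_le_mul_right ?_ (Real.exp_pos (l * (r * n)))
  rw [mul_assoc, ← h6]
  linarith

end Hypercube

/-! ### Averaging the density ratio over overlaps -/

lemma densityRatio_mono {B r r' : ℝ} (h : |r| ≤ |r'|) (h1 : |r'| < 1) :
    densityRatio B r ≤ densityRatio B r' := by
  have hr2 : 0 < 1 - r' ^ 2 := by
    have := (sq_lt_one_iff_abs_lt_one r').2 h1
    linarith
  have hsq := sq_le_sq.2 h
  unfold densityRatio
  gcongr ?_ * Real.exp ?_
  · gcongr
  · rw [div_le_div_iff₀ (by positivity) (by positivity)]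
    nlinarith [mul_le_mul_of_nonneg_left h (sq_nonneg B)]

/-- The hypothesis gives 1 - r² ≥ 1 - |r| ≥ 1/n. It will hold off overlap ±1 because overlaps are
discrete, so the singular factor costs only √n. -/
lemma densityRatio_le_sqrt_mul {n : ℕ} {B r : ℝ} (hr : |r| < 1) (h : 1 ≤ n * (1 - |r|)) :
    densityRatio B r ≤ √n * Real.exp (B ^ 2 * |r| / (1 + |r|)) := by
  unfold densityRatio
  gcongr
  have hr2 : 0 < 1 - r ^ 2 := by
    have := (sq_lt_one_iff_abs_lt_one r).2 hr
    linarith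
  rw [inv_le_iff_one_le_mul₀ (Real.sqrt_pos.2 hr2), ← Real.sqrt_mul (by positivity),
    Real.one_le_sqrt]
  refine h.trans ?_
  gcongr
  rw [← sq_abs]
  nlinarith [abs_nonneg r]

lemma tendsto_pow_mul_exp_neg {a : ℝ} (ha : 0 < a) (k : ℕ) :
    Tendsto (fun x : ℝ => x ^ k * Real.exp (-a * x)) atTop (𝓝 0) := by
  simpa using tendsto_rpow_mul_exp_neg_mul_atTop_nhds_zero (k : ℝ) a ha

/-- An upper bound for the averaged density ratio over a pair of configurations. -/
noncomputable def overlapBound (b g : ℝ) (n : ℕ) : ℝ :=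
  densityRatio 0 (√(√n))⁻¹ * Real.exp (b ^ 2 * (√(√n))⁻¹) +
    (n + 1) * √n * Real.exp (-(1 / 4) * √n) + 2 * √n * Real.exp (-g * n)

lemma tendsto_overlapBound (b : ℝ) {g : ℝ} (hg : 0 < g) :
    Tendsto (overlapBound b g) atTop (𝓝 1) := by
  have hs : Tendsto (fun n : ℕ => √(n : ℝ)) atTop atTop :=
    Real.tendsto_sqrt_atTop.comp tendsto_natCast_atTop_atTop
  have he : Tendsto (fun n : ℕ => (√(√(n : ℝ)))⁻¹) atTop (𝓝 0) :=
    tendsto_inv_atTop_zero.comp (Real.tendsto_sqrt_atTop.comp hs)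
  have h1 : Tendsto (fun n : ℕ => densityRatio 0 (√(√n))⁻¹ * Real.exp (b ^ 2 * (√(√n))⁻¹))
      atTop (𝓝 1) := by
    have hc : ContinuousAt
        (fun x : ℝ => (√(1 - x ^ 2))⁻¹ * Real.exp (0 ^ 2 * |x| / (1 + |x|)) *
          Real.exp (b ^ 2 * x)) 0 := by
      have : ∀ x : ℝ, 1 + |x| ≠ 0 := fun x => by positivity
      refine ContinuousAt.mul (ContinuousAt.mul (ContinuousAt.inv₀ (by fun_prop) (by simp)) ?_)
        (by fun_prop)
      simp only [ne_eq, OfNat.ofNat_ne_zero, not_false_eq_true, zero_pow, zero_mul, zero_div]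
      fun_prop
    have := hc.tendsto.comp he
    simpa [densityRatio, Function.comp_def] using this
  have h2 : Tendsto (fun n : ℕ => ((n : ℝ) + 1) * √n * Real.exp (-(1 / 4) * √n))
      atTop (𝓝 0) := by
    have a := (tendsto_pow_mul_exp_neg (a := 1 / 4) (by norm_num) 3).comp hs
    have b := (tendsto_pow_mul_exp_neg (a := 1 / 4) (by norm_num) 1).comp hs
    have := a.add b
    rw [add_zero] at this
    refine this.congr fun n => ?_
    have : √(n : ℝ) ^ 2 = n := Real.sq_sqrt (by positivity)
    simp only [Function.comp_apply]
    linear_combination (√(n : ℝ) * Real.exp (-(1 / 4) * √n)) * this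
  have h3 : Tendsto (fun n : ℕ => 2 * √n * Real.exp (-g * n)) atTop (𝓝 0) := by
    have a := ((tendsto_pow_mul_exp_neg hg 1).comp tendsto_natCast_atTop_atTop).const_mul 2
    rw [mul_zero] at a
    refine squeeze_zero (fun n => by positivity) (fun n => ?_) a
    have : √(n : ℝ) ≤ n := by
      rcases Nat.eq_zero_or_pos n with rfl | h
      · simp
      · rw [Real.sqrt_le_left (by positivity)]
        have : (1 : ℝ) ≤ n := by exact_mod_cast h
        nlinarith
    simp only [Function.comp_apply, pow_one, ← mul_assoc]
    gcongr
  have h := (h1.add h2).add h3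
  rw [add_zero, add_zero] at h
  exact h

set_option maxHeartbeats 1000000 in
/-- Below the critical level, for large `p`, the averaged density ratio over overlaps different
from `±1` is at most `overlapBound`. -/
lemma exists_sum_densityRatio_le {b : ℝ} (hb : b ^ 2 / 2 < Real.log 2) :
    ∃ P : ℕ, ∃ g > 0, ∀ p ≥ P, ∀ n : ℕ, 2 ≤ n →
      ∑ s ∈ (hypercube n).filter (fun s => |∑ j, s j| ≠ (n : ℝ)),
        densityRatio (b * √n) (((∑ j, s j) / n) ^ p) ≤ 2 ^ n * overlapBound b g n := by
  -- Half the entropy gap: at most 2 exp(gn) configurations, each contributing √n exp(b²n/2), total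
  -- 2√n · 2^n exp(-gn).
  set g : ℝ := (Real.log 2 - b ^ 2 / 2) / 2 with hgdef
  have hg : 0 < g := by simp only [hgdef]; linarith
  obtain ⟨l, hl0, hl⟩ : ∃ l : ℝ, 0 < l ∧ Real.exp (-2 * l) < g / 2 := by
    have : Tendsto (fun l : ℝ => Real.exp (-2 * l)) atTop (𝓝 0) := by
      have := (tendsto_pow_mul_exp_neg (a := 2) (by norm_num) 0)
      simpa using this
    exact ((eventually_gt_atTop 0).and (this.eventually_lt_const (by positivity))).exists
  -- Close enough to 1 that at most 2 exp(gn) configurations have |overlap| ≥ r; the maximum with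
  -- 1/2 only keeps r positive.
  set r : ℝ := max (1 / 2) (1 - g / 2 / l) with hrdef
  have hr0 : 0 < r := lt_of_lt_of_le (by norm_num) (le_max_left _ _)
  have hr1 : r < 1 := max_lt (by norm_num) (by have := div_pos (half_pos hg) hl0; linarith)
  have hlr : Real.exp (-2 * l) + l * (1 - r) ≤ g := by
    have h1 : 1 - g / 2 / l ≤ r := le_max_right _ _
    have h2 : l * (1 - r) ≤ l * (g / 2 / l) := by gcongr; linarith
    rw [mul_div_cancel₀ _ hl0.ne'] at h2
    linarith
  obtain ⟨P, hP⟩ : ∃ P : ℕ, ∀ p ≥ P, b ^ 2 * r ^ p ≤ 1 / 4 := by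
    have h := (tendsto_pow_atTop_nhds_zero_of_lt_one hr0.le hr1).const_mul (b ^ 2)
    rw [mul_zero] at h
    exact eventually_atTop.1 (h.eventually_le_const (by norm_num))
  -- The 5 allows the small-overlap exponent n e⁵ = e → 0 with e = n^(-1/4), and it leaves p - 2 ≥ P
  -- for the intermediate overlaps.
  refine ⟨P + 5, g, hg, fun p hp n hn => ?_⟩
  have hn0 : (0 : ℝ) < n := by exact_mod_cast (by omega : 0 < n)
  set e : ℝ := (√(√n))⁻¹ with hedef
  have hsn : 1 < √(n : ℝ) := by
    rw [Real.lt_sqrt (by norm_num)]; norm_num; exact_mod_cast (by omega : 1 < n)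
  have hssn : 1 < √√(n : ℝ) := by rw [Real.lt_sqrt (by norm_num)]; simpa using hsn
  have he0 : 0 < e := by positivity
  have he1 : e < 1 := inv_lt_one_of_one_lt₀ hssn
  have he4 : n * e ^ 4 = 1 := by
    have : (√√(n : ℝ)) ^ 4 = n := by
      rw [show 4 = 2 * 2 by norm_num, pow_mul, Real.sq_sqrt (by positivity),
        Real.sq_sqrt (by positivity)]
    rw [hedef, inv_pow, this, mul_inv_cancel₀ hn0.ne']
  have he2 : n * e ^ 2 = √n := by
    rw [hedef, inv_pow, Real.sq_sqrt (by positivity)]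
    nth_rw 1 [← Real.mul_self_sqrt hn0.le]
    field_simp
  set D : (Fin n → ℝ) → ℝ := fun s => densityRatio (b * √n) (((∑ j, s j) / n) ^ p)
  have hD0 : ∀ s, 0 ≤ D s := fun s => densityRatio_nonneg _ _
  set q : (Fin n → ℝ) → ℝ := fun s => |(∑ j, s j) / n| with hq
  have hB : (b * √n) ^ 2 = b ^ 2 * n := by rw [mul_pow, Real.sq_sqrt (by positivity)]
  have hq1 : ∀ s ∈ hypercube n, |∑ j, s j| ≠ (n : ℝ) → q s < 1 ∧ 1 ≤ n * (1 - q s) := by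
    intro s hs h
    have h1 := abs_sum_le_sub_one hs h
    have h2 : n * q s = |∑ j, s j| := by
      simp only [hq]
      rw [abs_div, Nat.abs_cast, mul_div_cancel₀ _ hn0.ne']
    constructor
    · simp only [hq]
      rw [abs_div, Nat.abs_cast, div_lt_one hn0]; linarith
    · linarith
  have hDsqrt : ∀ s ∈ hypercube n, |∑ j, s j| ≠ (n : ℝ) →
      D s ≤ √n * Real.exp (b ^ 2 * n * q s ^ p / (1 + q s ^ p)) := by
    intro s hs h
    obtain ⟨h1, h2⟩ := hq1 s hs h
    have h3 : q s ^ p ≤ q s := pow_le_of_le_one (abs_nonneg _) h1.le (by omega)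
    have h4 : |((∑ j, s j) / n) ^ p| = q s ^ p := abs_pow _ _
    have := densityRatio_le_sqrt_mul (n := n) (B := b * √n) (r := ((∑ j, s j) / n) ^ p)
      (by rw [h4]; linarith) (by rw [h4]; nlinarith)
    rwa [h4, hB] at this
  -- overlaps close to zero
  have hsmall : ∑ s ∈ (hypercube n).filter (fun s => |∑ j, s j| ≠ (n : ℝ) ∧ q s ≤ e), D s ≤
      2 ^ n * (densityRatio 0 e * Real.exp (b ^ 2 * e)) := by
    calc _ ≤ ((hypercube n).filter (fun s => |∑ j, s j| ≠ (n : ℝ) ∧ q s ≤ e)).card •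
          (densityRatio 0 e * Real.exp (b ^ 2 * e)) := by
          refine Finset.sum_le_card_nsmul _ _ _ fun s hs => ?_
          obtain ⟨hs, h, hqe⟩ := Finset.mem_filter.1 hs
          have h4 : |((∑ j, s j) / n) ^ p| = q s ^ p := abs_pow _ _
          have h5 : q s ^ p ≤ e ^ 5 := (pow_le_pow_left₀ (abs_nonneg _) hqe p).trans
            (pow_le_pow_of_le_one he0.le he1.le (by omega))
          have h6 : e ^ 5 < 1 := pow_lt_one₀ he0.le he1 (by norm_num)
          have h7 : e ^ 5 ≤ e := pow_le_of_le_one he0.le he1.le (by norm_num)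
          refine (densityRatio_mono (r' := e ^ 5) ?_ ?_).trans ?_
          · rw [h4, abs_of_pos (by positivity)]; exact h5
          · rwa [abs_of_pos (by positivity)]
          · have h8 : 0 < 1 - e ^ 2 := by nlinarith
            have h9 : densityRatio 0 e = (√(1 - e ^ 2))⁻¹ := by simp [densityRatio]
            rw [h9, densityRatio, hB, abs_of_pos (pow_pos he0 5)]
            refine mul_le_mul ?_ (Real.exp_le_exp.2 ?_) (Real.exp_pos _).le (by positivity)
            · gcongr
            · refine (div_le_self (by positivity) (by linarith [pow_pos he0 5])).trans_eq ?_
              linear_combination (b ^ 2 * e) * he4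
      _ ≤ _ := by
          rw [nsmul_eq_mul]
          gcongr
          · exact mul_nonneg (densityRatio_nonneg _ _) (Real.exp_pos _).le
          · exact_mod_cast (Finset.card_filter_le _ _).trans_eq card_hypercube
  -- intermediate overlaps
  have hmid : ∑ s ∈ (hypercube n).filter (fun s => |∑ j, s j| ≠ (n : ℝ) ∧ e < q s ∧ q s < r), D s ≤
      2 ^ n * ((n + 1) * √n * Real.exp (-(1 / 4) * √n)) := by
    set T := (hypercube n).filter (fun s => |∑ j, s j| ≠ (n : ℝ) ∧ e < q s ∧ q s < r)
    set V : Finset ℝ := (Finset.range (n + 1)).image fun k : ℕ => (n : ℝ) - 2 * k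
    have hmaps : ∀ s ∈ T, ∑ j, s j ∈ V := fun s hs => by
      obtain ⟨k, hk, h⟩ := exists_sum_eq_of_mem_hypercube (Finset.mem_filter.1 hs).1
      exact Finset.mem_image.2 ⟨k, Finset.mem_range.2 (by omega), h.symm⟩
    -- On the fibre of magnetization m the entropy factor exp(-m²/(2n)) beats the ratio factor
    -- exp(m²/(4n)), and m²/n ≥ n e² = √n. There are at most n + 1 fibres.
    rw [← Finset.sum_fiberwise_of_maps_to hmaps]
    calc _ ≤ V.card • (2 ^ n * (√n * Real.exp (-(1 / 4) * √n))) := by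
          refine Finset.sum_le_card_nsmul _ _ _ fun m _ => ?_
          rcases (T.filter fun s => ∑ j, s j = m).eq_empty_or_nonempty with h0 | ⟨s₀, hs₀⟩
          · rw [h0]; simp; positivity
          obtain ⟨hs₀, hm⟩ := Finset.mem_filter.1 hs₀
          obtain ⟨-, -, hme, hmr⟩ := Finset.mem_filter.1 hs₀
          have hqm : ∀ s : Fin n → ℝ, ∑ j, s j = m → q s = |m / n| := fun s hs => by
            simp only [hq, hs]
          rw [hqm _ hm] at hme hmr
          have hmn : n * |m / n| ^ 2 = m ^ 2 / n := by rw [sq_abs]; field_simp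
          have hD : ∀ s ∈ T.filter fun s => ∑ j, s j = m,
              D s ≤ √n * Real.exp (m ^ 2 / n / 4) := by
            intro s hs
            obtain ⟨hs, hsm⟩ := Finset.mem_filter.1 hs
            obtain ⟨hs, hne, -⟩ := Finset.mem_filter.1 hs
            refine (hDsqrt s hs hne).trans ?_
            rw [hqm _ hsm]
            gcongr ?_ * Real.exp ?_
            have h0 : b ^ 2 * n * |m / n| ^ p / (1 + |m / n| ^ p) ≤ b ^ 2 * n * |m / n| ^ p :=
              div_le_self (by positivity) (by linarith [pow_nonneg (abs_nonneg (m / n)) p])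
            refine h0.trans ?_
            have h1 : |m / n| ^ (p - 2) ≤ r ^ (p - 2) := by gcongr
            have h2 := hP (p - 2) (by omega)
            have h3 : |m / n| ^ p = |m / n| ^ 2 * |m / n| ^ (p - 2) := by
              rw [← pow_add]; congr 1; omega
            calc b ^ 2 * n * |m / n| ^ p
                = (n * |m / n| ^ 2) * (b ^ 2 * |m / n| ^ (p - 2)) := by rw [h3]; ring
              _ ≤ (n * |m / n| ^ 2) * (1 / 4) := by
                  gcongr
                  exact (mul_le_mul_of_nonneg_left h1 (sq_nonneg b)).trans h2
              _ = _ := by rw [hmn]; ring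
          refine (Finset.sum_le_card_nsmul _ _ _ hD).trans ?_
          rw [nsmul_eq_mul]
          have hcard : ((T.filter fun s => ∑ j, s j = m).card : ℝ) ≤
              2 ^ n * Real.exp (-(m ^ 2 / (2 * n))) := by
            refine le_trans ?_ (card_sum_eq_le m)
            exact_mod_cast Finset.card_le_card
              (Finset.filter_subset_filter _ (Finset.filter_subset _ _))
          calc _ ≤ 2 ^ n * Real.exp (-(m ^ 2 / (2 * n))) * (√n * Real.exp (m ^ 2 / n / 4)) := by
                gcongr
            _ = 2 ^ n * (√n * Real.exp (-(m ^ 2 / n / 4))) := by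
                have : Real.exp (-(m ^ 2 / n / 4)) =
                    Real.exp (-(m ^ 2 / (2 * n))) * Real.exp (m ^ 2 / n / 4) := by
                  rw [← Real.exp_add]; congr 1; field_simp; ring
                rw [this]; ring
            _ ≤ _ := by
                gcongr
                have : √n ≤ m ^ 2 / n := by rw [← he2, ← hmn]; gcongr
                linarith
      _ ≤ _ := by
          rw [nsmul_eq_mul]
          have : (V.card : ℝ) ≤ n + 1 := by
            have h : V.card ≤ n + 1 := Finset.card_image_le.trans_eq (Finset.card_range _)
            exact_mod_cast h
          calc _ ≤ ((n : ℝ) + 1) * (2 ^ n * (√n * Real.exp (-(1 / 4) * √n))) := by gcongr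
            _ = _ := by ring
  -- overlaps close to one
  have hbig : ∑ s ∈ (hypercube n).filter (fun s => |∑ j, s j| ≠ (n : ℝ) ∧ r ≤ q s), D s ≤
      2 ^ n * (2 * √n * Real.exp (-g * n)) := by
    -- Uses t / (1 + t) ≤ 1/2 for t = `q s ^ p` in [0, 1].
    have hD : ∀ s ∈ (hypercube n).filter (fun s => |∑ j, s j| ≠ (n : ℝ) ∧ r ≤ q s),
        D s ≤ √n * Real.exp (b ^ 2 / 2 * n) := by
      intro s hs
      obtain ⟨hs, hne, -⟩ := Finset.mem_filter.1 hs
      refine (hDsqrt s hs hne).trans ?_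
      gcongr
      have h1 : 0 ≤ q s ^ p := pow_nonneg (abs_nonneg _) p
      have h2 : q s ^ p ≤ 1 := pow_le_one₀ (abs_nonneg _) (hq1 s hs hne).1.le
      rw [div_le_iff₀ (by linarith)]
      have : 0 ≤ b ^ 2 * n := by positivity
      nlinarith
    refine (Finset.sum_le_card_nsmul _ _ _ hD).trans ?_
    rw [nsmul_eq_mul]
    have hcard : (((hypercube n).filter (fun s => |∑ j, s j| ≠ (n : ℝ) ∧ r ≤ q s)).card : ℝ) ≤
        2 * Real.exp (g * n) := by
      refine le_trans ?_ ((card_abs_sum_ge_le (n := n) (r := r) hl0.le).trans ?_)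
      · refine Nat.cast_le.2 (Finset.card_le_card fun s hs => ?_)
        obtain ⟨hs, -, h⟩ := Finset.mem_filter.1 hs
        refine Finset.mem_filter.2 ⟨hs, ?_⟩
        simp only [hq] at h
        rwa [abs_div, Nat.abs_cast, le_div_iff₀ hn0] at h
      · gcongr
    have h2n : (2 : ℝ) ^ n = Real.exp (Real.log 2 * n) := by
      rw [mul_comm, Real.exp_nat_mul, Real.exp_log (by norm_num)]
    have hexp : Real.exp (g * n) * Real.exp (b ^ 2 / 2 * n) = 2 ^ n * Real.exp (-g * n) := by
      rw [h2n, ← Real.exp_add, ← Real.exp_add]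
      congr 1
      simp only [hgdef]
      ring
    calc _ ≤ 2 * Real.exp (g * n) * (√n * Real.exp (b ^ 2 / 2 * n)) := by gcongr
      _ = 2 * √n * (Real.exp (g * n) * Real.exp (b ^ 2 / 2 * n)) := by ring
      _ = _ := by rw [hexp]; ring
  have hsplit : ∑ s ∈ (hypercube n).filter (fun s => |∑ j, s j| ≠ (n : ℝ)), D s ≤
      ∑ s ∈ (hypercube n).filter (fun s => |∑ j, s j| ≠ (n : ℝ) ∧ q s ≤ e), D s +
      ∑ s ∈ (hypercube n).filter (fun s => |∑ j, s j| ≠ (n : ℝ) ∧ e < q s ∧ q s < r), D s +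
      ∑ s ∈ (hypercube n).filter (fun s => |∑ j, s j| ≠ (n : ℝ) ∧ r ≤ q s), D s := by
    simp only [Finset.sum_filter, ← Finset.sum_add_distrib]
    refine Finset.sum_le_sum fun s _ => ?_
    have := hD0 s
    split_ifs <;> first | linarith | (exfalso; grind)
  refine hsplit.trans ?_
  unfold overlapBound
  rw [mul_add, mul_add]
  linarith

/-! ### The Hamiltonian as a Gaussian process and its pair probabilities -/

section SpinVector

variable {n p : ℕ}

instance : IsProbabilityMeasure (disorder n p) := by unfold disorder; infer_instance

/-- The coefficients of `√n H(σ)` as a linear functional of the disorder. -/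
noncomputable def spinVector (p : ℕ) (σ : Fin n → ℝ) (i : Fin p → Fin n) : ℝ :=
  (√n ^ p)⁻¹ * ∏ k, σ (i k)

lemma sqrt_mul_hamiltonian (hn : 0 < n) (J : Tensor n p) (σ : Fin n → ℝ) :
    √n * hamiltonian J σ = ∑ i, J i * spinVector p σ i := by
  have hn0 : (0 : ℝ) < n := by exact_mod_cast hn
  have h1 : (n : ℝ) ^ (-((p : ℝ) + 1) / 2) = (√n)⁻¹ * (√n ^ p)⁻¹ := by
    rw [show -((p : ℝ) + 1) / 2 = -((1 / 2) * ((p + 1 : ℕ) : ℝ)) by push_cast; ring,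
      Real.rpow_neg hn0.le, Real.rpow_mul hn0.le, Real.rpow_natCast, ← Real.sqrt_eq_rpow,
      pow_succ', mul_inv]
  have h2 : √(n : ℝ) ≠ 0 := (Real.sqrt_pos.2 hn0).ne'
  unfold hamiltonian spinVector
  rw [h1, ← mul_assoc, ← mul_assoc, mul_inv_cancel₀ h2, one_mul, Finset.mul_sum]
  exact Finset.sum_congr rfl fun i _ => by ring

/-- The sum over multi-indices of a product factorizes into a `p`-th power; this is the covariance
of the rescaled energies. -/
lemma sum_spinVector_mul (σ τ : Fin n → ℝ) :
    ∑ i, spinVector p σ i * spinVector p τ i = ((∑ j, (σ * τ) j) / n) ^ p := by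
  have h1 : ∀ i : Fin p → Fin n, spinVector p σ i * spinVector p τ i =
      ((n : ℝ) ^ p)⁻¹ * ∏ k, (σ * τ) (i k) := fun i => by
    have : (√(n : ℝ) ^ p)⁻¹ * (√(n : ℝ) ^ p)⁻¹ = ((n : ℝ) ^ p)⁻¹ := by
      rw [← mul_inv, ← mul_pow, Real.mul_self_sqrt (Nat.cast_nonneg n)]
    simp only [spinVector, Pi.mul_apply, Finset.prod_mul_distrib]
    rw [← this]
    ring
  simp_rw [h1]
  rw [← Finset.mul_sum, ← Fintype.sum_pow, div_pow, div_eq_inv_mul]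

lemma sum_spinVector_sq (hn : 0 < n) {σ : Fin n → ℝ} (hσ : σ ∈ hypercube n) :
    ∑ i, spinVector p σ i ^ 2 = 1 := by
  have hn0 : (n : ℝ) ≠ 0 := by exact_mod_cast hn.ne'
  simp_rw [pow_two, sum_spinVector_mul, Pi.mul_apply, sq_apply_of_mem_hypercube hσ]
  simp [hn0]

lemma measurable_hamiltonian (σ : Fin n → ℝ) :
    Measurable fun J : Tensor n p => hamiltonian J σ := by
  unfold hamiltonian; fun_prop

lemma map_sqrt_mul_hamiltonian (hn : 0 < n) {σ : Fin n → ℝ} (hσ : σ ∈ hypercube n) :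
    (disorder n p).map (fun J => √n * hamiltonian J σ) = gaussianReal 0 1 := by
  simp_rw [sqrt_mul_hamiltonian hn]
  rw [disorder, map_linear_pi_gaussianReal, sum_spinVector_sq hn hσ, Real.toNNReal_one]

lemma mem_Icc_hamiltonian_iff (hn : 0 < n) (J : Tensor n p) (σ : Fin n → ℝ) {u v : ℝ} :
    hamiltonian J σ ∈ Set.Icc u v ↔ √n * hamiltonian J σ ∈ Set.Icc (√n * u) (√n * v) := by
  have hn0 : 0 < √(n : ℝ) := Real.sqrt_pos.2 (by exact_mod_cast hn)
  simp [Set.mem_Icc, mul_le_mul_iff_right₀ hn0]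

lemma measureReal_hamiltonian_mem_Icc (hn : 0 < n) {σ : Fin n → ℝ} (hσ : σ ∈ hypercube n)
    (u v : ℝ) : (disorder n p).real {J | hamiltonian J σ ∈ Set.Icc u v} =
      (gaussianReal 0 1).real (Set.Icc (√n * u) (√n * v)) := by
  rw [← map_sqrt_mul_hamiltonian hn hσ (p := p), measureReal_def, measureReal_def,
    Measure.map_apply ((measurable_hamiltonian σ).const_mul _) measurableSet_Icc]
  simp_rw [mem_Icc_hamiltonian_iff hn]
  rfl

lemma abs_le_of_mem_Icc {b c u v y : ℝ} (hc : 0 ≤ c) (hu : |u| ≤ b) (hv : |v| ≤ b)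
    (hy : y ∈ Set.Icc (c * u) (c * v)) : |y| ≤ b * c := by
  have h1 := mul_le_mul_of_nonneg_left (abs_le.1 hu).1 hc
  have h2 := mul_le_mul_of_nonneg_left (abs_le.1 hv).2 hc
  rw [abs_le]
  constructor <;> linarith [hy.1, hy.2]

lemma measureReal_pair_le (hn : 0 < n) {σ τ : Fin n → ℝ} (hσ : σ ∈ hypercube n)
    (hτ : τ ∈ hypercube n) (hp : p ≠ 0) (hστ : |∑ j, (σ * τ) j| ≠ (n : ℝ)) {b u v : ℝ}
    (hu : |u| ≤ b) (hv : |v| ≤ b) :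
    (disorder n p).real ({J | hamiltonian J σ ∈ Set.Icc u v} ∩
        {J | hamiltonian J τ ∈ Set.Icc u v}) ≤
      densityRatio (b * √n) (((∑ j, (σ * τ) j) / n) ^ p) *
        (gaussianReal 0 1).real (Set.Icc (√n * u) (√n * v)) ^ 2 := by
  have hn0 : (0 : ℝ) < n := by exact_mod_cast hn
  have hr : |((∑ j, (σ * τ) j) / (n : ℝ)) ^ p| < 1 := by
    rw [abs_pow]
    refine pow_lt_one₀ (abs_nonneg _) ?_ hp
    rw [abs_div, Nat.abs_cast, div_lt_one hn0]
    linarith [abs_sum_le_sub_one (mul_mem_hypercube hσ hτ) hστ]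
  have h := measure_linear_pair_le (sum_spinVector_sq hn hσ) (sum_spinVector_sq hn hτ)
    (sum_spinVector_mul σ τ) hr (measurableSet_Icc (a := √n * u) (b := √n * v))
    (fun y hy => abs_le_of_mem_Icc (Real.sqrt_nonneg _) hu hv hy)
  have h2 := ENNReal.toReal_mono (by finiteness) h
  rw [ENNReal.toReal_mul, ENNReal.toReal_ofReal (densityRatio_nonneg _ _),
    ENNReal.toReal_pow] at h2
  have hset : {J : Tensor n p | hamiltonian J σ ∈ Set.Icc u v} ∩
      {J | hamiltonian J τ ∈ Set.Icc u v} =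
      {J | ∑ i, J i * spinVector p σ i ∈ Set.Icc (√n * u) (√n * v) ∧
        ∑ i, J i * spinVector p τ i ∈ Set.Icc (√n * u) (√n * v)} := by
    ext J
    simp only [Set.mem_inter_iff, Set.mem_ofPred_eq, mem_Icc_hamiltonian_iff hn,
      sqrt_mul_hamiltonian hn]
  rw [hset]
  exact h2

/-- Any constant serves here, since these are the degenerate pairs τ = ±σ. The Chernoff bound with l
= (log n)/2 and r = 1 gives 2e < 6. -/
lemma card_abs_sum_eq_le (hn : 0 < n) :
    (((hypercube n).filter fun s => |∑ j, s j| = (n : ℝ)).card : ℝ) ≤ 6 := by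
  have hn0 : (0 : ℝ) < n := by exact_mod_cast hn
  have h := card_abs_sum_ge_le (n := n) (l := Real.log n / 2) (r := 1)
    (div_nonneg (Real.log_natCast_nonneg n) (by norm_num))
  have e : (Real.exp (-2 * (Real.log n / 2)) + Real.log n / 2 * (1 - 1)) * n = 1 := by
    rw [show -2 * (Real.log (n : ℝ) / 2) = -Real.log n by ring, Real.exp_neg, Real.exp_log hn0]
    field_simp
    ring
  rw [e] at h
  refine le_trans (Nat.cast_le.2 (Finset.card_le_card fun s hs => ?_))
    (h.trans (by linarith [Real.exp_one_lt_d9]))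
  obtain ⟨hs, h⟩ := Finset.mem_filter.1 hs
  exact Finset.mem_filter.2 ⟨hs, by rw [h, one_mul]⟩

lemma sum_measureReal_pair_le (hn : 0 < n) (hp : p ≠ 0) {b u v B : ℝ} (hu : |u| ≤ b)
    (hv : |v| ≤ b) (hB : ∑ s ∈ (hypercube n).filter (fun s => |∑ j, s j| ≠ (n : ℝ)),
        densityRatio (b * √n) (((∑ j, s j) / n) ^ p) ≤ 2 ^ n * B) :
    ∑ σ ∈ hypercube n, ∑ τ ∈ hypercube n,
      (disorder n p).real ({J | hamiltonian J σ ∈ Set.Icc u v} ∩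
        {J | hamiltonian J τ ∈ Set.Icc u v}) ≤
      2 ^ n * (2 ^ n * B * (gaussianReal 0 1).real (Set.Icc (√n * u) (√n * v)) ^ 2 +
        6 * (gaussianReal 0 1).real (Set.Icc (√n * u) (√n * v))) := by
  classical
  set γ := (gaussianReal 0 1).real (Set.Icc (√n * u) (√n * v)) with hγ
  have hγ0 : 0 ≤ γ := measureReal_nonneg
  have hrow : ∀ σ ∈ hypercube n, ∑ τ ∈ hypercube n,
      (disorder n p).real ({J | hamiltonian J σ ∈ Set.Icc u v} ∩
        {J | hamiltonian J τ ∈ Set.Icc u v}) ≤ 2 ^ n * B * γ ^ 2 + 6 * γ := by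
    intro σ hσ
    -- At overlap ±1 the joint law is degenerate, so the pair probability is bounded by a single
    -- one.
    set F : (Fin n → ℝ) → ℝ := fun s => if |∑ j, s j| ≠ (n : ℝ) then
      densityRatio (b * √n) (((∑ j, s j) / n) ^ p) * γ ^ 2 else γ
    calc _ ≤ ∑ τ ∈ hypercube n, F (σ * τ) := by
          refine Finset.sum_le_sum fun τ hτ => ?_
          simp only [F]
          split_ifs with h
          · exact measureReal_pair_le hn hσ hτ hp h hu hv
          · rw [hγ, ← measureReal_hamiltonian_mem_Icc hn hσ (p := p)]
            exact measureReal_mono Set.inter_subset_left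
      _ = ∑ s ∈ hypercube n, F s := sum_hypercube_mul hσ F
      _ ≤ _ := by
          simp only [F]
          rw [Finset.sum_ite, ← Finset.sum_mul, Finset.sum_const, nsmul_eq_mul]
          simp only [not_not]
          gcongr
          exact card_abs_sum_eq_le hn
  refine (Finset.sum_le_card_nsmul _ _ _ hrow).trans_eq ?_
  rw [card_hypercube, nsmul_eq_mul]
  push_cast
  ring

end SpinVector

/-! ### Concentration of the number of configurations at a given energy -/

/-- Chebyshev's inequality for the number of events that occur. -/
lemma measureReal_count_le_half {Ω ι : Type*} [MeasurableSpace Ω] {μ : Measure Ω}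
    [IsProbabilityMeasure μ] (I : Finset ι) {S : ι → Set Ω} (hS : ∀ i ∈ I, MeasurableSet (S i))
    {M ε : ℝ} (hM : 0 < M) (h1 : ∑ i ∈ I, μ.real (S i) = M)
    (h2 : ∑ i ∈ I, ∑ j ∈ I, μ.real (S i ∩ S j) ≤ M ^ 2 * (1 + ε)) :
    μ.real {ω | ∑ i ∈ I, (S i).indicator 1 ω ≤ M / 2} ≤ 4 * ε := by
  set N : Ω → ℝ := fun ω => ∑ i ∈ I, (S i).indicator 1 ω
  have hmem : MemLp N 2 μ :=
    memLp_finsetSum _ fun i hi => memLp_indicator_const 2 (hS i hi) (1 : ℝ) (Or.inr (by simp))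
  have hint : ∀ T, MeasurableSet T → Integrable (T.indicator (1 : Ω → ℝ)) μ := fun T hT =>
    (integrable_const (1 : ℝ)).indicator hT
  have hE : μ[N] = M := by
    rw [integral_finsetSum _ fun i hi => hint _ (hS i hi), ← h1]
    exact Finset.sum_congr rfl fun i hi => integral_indicator_one (hS i hi)
  have hE2 : μ[N ^ 2] ≤ M ^ 2 * (1 + ε) := by
    have : N ^ 2 = fun ω => ∑ i ∈ I, ∑ j ∈ I, (S i ∩ S j).indicator (1 : Ω → ℝ) ω := by
      ext ω
      simp only [N, Pi.pow_apply, pow_two, Finset.sum_mul_sum, Set.inter_indicator_one,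
        Pi.mul_apply]
    rw [this, integral_finsetSum _ fun i hi => integrable_finsetSum _ fun j hj =>
      hint _ ((hS i hi).inter (hS j hj))]
    refine le_of_eq_of_le (Finset.sum_congr rfl fun i hi => ?_) h2
    rw [integral_finsetSum _ fun j hj => hint _ ((hS i hi).inter (hS j hj))]
    exact Finset.sum_congr rfl fun j hj => integral_indicator_one ((hS i hi).inter (hS j hj))
  have hvar : Var[N; μ] ≤ M ^ 2 * ε := by
    rw [variance_eq_sub hmem, hE]; linarith
  have hch := meas_ge_le_variance_div_sq hmem (half_pos hM)
  have hsub : {ω | N ω ≤ M / 2} ⊆ {ω | M / 2 ≤ |N ω - μ[N]|} := fun ω hω => by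
    simp only [Set.mem_ofPred_eq, hE] at hω ⊢
    rw [abs_sub_comm]
    exact le_trans (by linarith) (le_abs_self _)
  have h3 := ENNReal.toReal_mono (by finiteness) ((measure_mono hsub).trans hch)
  rw [ENNReal.toReal_ofReal (div_nonneg (variance_nonneg _ _) (by positivity))] at h3
  refine h3.trans ?_
  rw [div_le_iff₀ (by positivity)]
  linarith

lemma gaussianReal_Icc_ge {n : ℕ} {b u v : ℝ} (hu : |u| ≤ b) (hv : |v| ≤ b) (huv : u ≤ v) :
    (√(2 * Real.pi))⁻¹ * Real.exp (-(b ^ 2 / 2 * n)) * (√n * (v - u)) ≤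
      (gaussianReal 0 1).real (Set.Icc (√n * u) (√n * v)) := by
  have huv' : √n * u ≤ √n * v := by gcongr
  have hvol : volume.real (Set.Icc (√n * u) (√n * v)) = √n * (v - u) := by
    rw [measureReal_def, Real.volume_Icc, ENNReal.toReal_ofReal (by linarith)]; ring
  rw [measureReal_def, gaussianReal_apply_eq_integral _ one_ne_zero,
    ENNReal.toReal_ofReal (setIntegral_nonneg measurableSet_Icc
      fun x _ => gaussianPDFReal_nonneg _ _ _), mul_comm, ← hvol, ← smul_eq_mul,
    ← setIntegral_const]
  refine setIntegral_mono_on (integrableOn_const (by simp))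
    (integrable_gaussianPDFReal _ _).integrableOn measurableSet_Icc fun x hx => ?_
  have hx' := abs_le_of_mem_Icc (Real.sqrt_nonneg _) hu hv hx
  have hx2 : x ^ 2 ≤ b ^ 2 * n := by
    rw [← Real.sq_sqrt (Nat.cast_nonneg (α := ℝ) n), ← mul_pow, ← sq_abs]
    gcongr
  unfold gaussianPDFReal
  simp only [NNReal.coe_one, mul_one, sub_zero]
  gcongr
  linarith

open Classical in
/-- Below the critical level, for large `p`, the number of configurations with energy in
`[u, v]` is exponentially large with high probability. -/
lemma exists_tendsto_card_lt {b u v : ℝ} (hb : b ^ 2 / 2 < Real.log 2) (hu : |u| ≤ b)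
    (hv : |v| ≤ b) (huv : u < v) :
    ∃ P : ℕ, ∀ p ≥ P, ∀ ε > 0, Tendsto (fun n : ℕ => (disorder n p).real {J |
      (((hypercube n).filter fun σ => hamiltonian J σ ∈ Set.Icc u v).card : ℝ) ≤
        Real.exp ((Real.log 2 - b ^ 2 / 2 - ε) * n)}) atTop (𝓝 0) := by
  obtain ⟨P, g, hg, hP⟩ := exists_sum_densityRatio_le hb
  refine ⟨P + 1, fun p hp ε hε => ?_⟩
  set K : ℝ := (√(2 * Real.pi))⁻¹ * (v - u) with hK
  have hK0 : 0 < K := mul_pos (by positivity) (by linarith)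
  set M : ℕ → ℝ := fun n => 2 ^ n * (gaussianReal 0 1).real (Set.Icc (√n * u) (√n * v)) with hMdef
  have h2n : ∀ n : ℕ, (2 : ℝ) ^ n = Real.exp (Real.log 2 * n) := fun n => by
    rw [mul_comm, Real.exp_nat_mul, Real.exp_log (by norm_num)]
  have hM : ∀ n : ℕ, 0 < n → K * Real.exp ((Real.log 2 - b ^ 2 / 2) * n) ≤ M n := by
    intro n hn
    have h1 : 1 ≤ √(n : ℝ) := by rw [Real.one_le_sqrt]; exact_mod_cast hn
    have h2 := gaussianReal_Icc_ge (n := n) hu hv huv.le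
    calc _ = 2 ^ n * ((√(2 * Real.pi))⁻¹ * Real.exp (-(b ^ 2 / 2 * n)) * (1 * (v - u))) := by
          rw [h2n, hK, show (Real.log 2 - b ^ 2 / 2) * n = Real.log 2 * n + -(b ^ 2 / 2 * n) by ring,
            Real.exp_add]
          ring
      _ ≤ 2 ^ n * ((√(2 * Real.pi))⁻¹ * Real.exp (-(b ^ 2 / 2 * n)) * (√n * (v - u))) := by
          gcongr
      _ ≤ _ := by simp only [hMdef]; gcongr
  have hMtop : Tendsto M atTop atTop := by
    have h1 : Tendsto (fun n : ℕ => K * Real.exp ((Real.log 2 - b ^ 2 / 2) * n)) atTop atTop :=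
      (Real.tendsto_exp_atTop.comp
        (tendsto_natCast_atTop_atTop.const_mul_atTop (by linarith))).const_mul_atTop hK0
    exact tendsto_atTop_mono' _ ((eventually_gt_atTop 0).mono hM) h1
  -- The Chebyshev error: the averaged ratio minus 1, plus the degenerate pairs, which contribute 6
  -- M against M².
  have hlim : Tendsto (fun n => 4 * ((overlapBound b g n - 1) + 6 * (M n)⁻¹)) atTop (𝓝 0) := by
    have := (((tendsto_overlapBound b hg).sub_const 1).add
      ((tendsto_inv_atTop_zero.comp hMtop).const_mul 6)).const_mul 4
    simpa using this
  have hexp : ∀ᶠ n : ℕ in atTop, Real.exp (-ε * n) ≤ K / 2 := by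
    have := (tendsto_pow_mul_exp_neg hε 0).comp (tendsto_natCast_atTop_atTop (R := ℝ))
    simp only [pow_zero, one_mul] at this
    exact this.eventually_le_const (half_pos hK0)
  refine squeeze_zero' (Eventually.of_forall fun _ => measureReal_nonneg) ?_ hlim
  filter_upwards [hexp, eventually_ge_atTop 2] with n hn hn2
  have hn0 : 0 < n := by omega
  have hMn : 0 < M n := lt_of_lt_of_le (by positivity) (hM n hn0)
  refine le_trans (measureReal_mono (fun J hJ => ?_)) (measureReal_count_le_half (hypercube n)
    (S := fun σ => {J : Tensor n p | hamiltonian J σ ∈ Set.Icc u v})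
    (fun σ _ => measurable_hamiltonian σ measurableSet_Icc) hMn ?_ ?_)
  · simp only [Set.mem_ofPred_eq] at hJ ⊢
    have : ∑ σ ∈ hypercube n, ({J : Tensor n p | hamiltonian J σ ∈ Set.Icc u v}).indicator
        (1 : Tensor n p → ℝ) J =
        (((hypercube n).filter fun σ => hamiltonian J σ ∈ Set.Icc u v).card : ℝ) := by
      rw [Finset.card_filter]
      push_cast
      exact Finset.sum_congr rfl fun σ _ => by simp [Set.indicator_apply]
    rw [this]
    refine hJ.trans ?_
    have h1 := hM n hn0
    have h2 : Real.exp ((Real.log 2 - b ^ 2 / 2 - ε) * n) =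
        Real.exp (-ε * n) * Real.exp ((Real.log 2 - b ^ 2 / 2) * n) := by
      rw [← Real.exp_add]; ring_nf
    rw [h2]
    calc _ ≤ K / 2 * Real.exp ((Real.log 2 - b ^ 2 / 2) * n) := by gcongr
      _ ≤ _ := by linarith
  · rw [Finset.sum_congr rfl fun σ hσ => measureReal_hamiltonian_mem_Icc hn0 hσ u v,
      Finset.sum_const, card_hypercube, nsmul_eq_mul]
    simp [hMdef]
  · refine (sum_measureReal_pair_le hn0 (by omega) hu hv
      (hP p (by omega) n hn2)).trans_eq ?_
    have : M n ^ 2 * (1 + ((overlapBound b g n - 1) + 6 * (M n)⁻¹)) =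
        M n ^ 2 * overlapBound b g n + 6 * M n := by field_simp; ring
    rw [this]
    simp only [hMdef]
    ring

/-! ### Annealed upper bounds for the partition function -/

section Annealed

variable {n p : ℕ}

lemma integrable_exp_hamiltonian_and_integral (hn : 0 < n) {σ : Fin n → ℝ} (hσ : σ ∈ hypercube n)
    (t : ℝ) : Integrable (fun J : Tensor n p => Real.exp (t * n * hamiltonian J σ)) (disorder n p) ∧
      ∫ J : Tensor n p, Real.exp (t * n * hamiltonian J σ) ∂disorder n p =
        Real.exp (t ^ 2 / 2 * n) := by
  have hX : Measurable fun J : Tensor n p => √n * hamiltonian J σ :=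
    (measurable_hamiltonian σ).const_mul _
  have h1 : ∀ J : Tensor n p, Real.exp (t * n * hamiltonian J σ) =
      Real.exp ((t * √n) * (√n * hamiltonian J σ)) := fun J => by
    congr 1
    linear_combination -(t * hamiltonian J σ) * Real.mul_self_sqrt (Nat.cast_nonneg (α := ℝ) n)
  simp_rw [h1]
  constructor
  · have h : Integrable (fun x : ℝ => Real.exp ((t * √n) * x))
        ((disorder n p).map fun J => √n * hamiltonian J σ) := by
      rw [map_sqrt_mul_hamiltonian hn hσ]
      exact integrable_exp_mul_gaussianReal _
    exact h.comp_measurable hX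
  · have h := mgf_gaussianReal (map_sqrt_mul_hamiltonian (p := p) hn hσ) (t * √n)
    rw [mgf] at h
    rw [h]
    congr 1
    simp only [NNReal.coe_one, zero_mul, zero_add, one_mul, mul_pow,
      Real.sq_sqrt (Nat.cast_nonneg (α := ℝ) n)]
    ring

lemma partition_pos (t : ℝ) (J : Tensor n p) : 0 < partition t J := by
  refine Finset.sum_pos (fun _ _ => Real.exp_pos _) (Finset.card_pos.1 ?_)
  rw [card_hypercube]; positivity

lemma measureReal_partition_ge_le (hn : 0 < n) (t ε : ℝ) :
    (disorder n p).real {J | Real.exp ((Real.log 2 + t ^ 2 / 2 + ε) * n) ≤ partition t J} ≤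
      Real.exp (-ε * n) := by
  have hint : Integrable (fun J : Tensor n p => partition t J) (disorder n p) :=
    integrable_finsetSum _ fun σ hσ => (integrable_exp_hamiltonian_and_integral hn hσ t).1
  have hE : ∫ J : Tensor n p, partition t J ∂disorder n p =
      Real.exp ((Real.log 2 + t ^ 2 / 2) * n) := by
    unfold partition
    rw [integral_finsetSum _ fun σ hσ => (integrable_exp_hamiltonian_and_integral hn hσ t).1,
      Finset.sum_congr rfl fun σ hσ => (integrable_exp_hamiltonian_and_integral hn hσ t).2,
      Finset.sum_const, card_hypercube, nsmul_eq_mul, add_mul, Real.exp_add,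
      mul_comm (Real.log 2), Real.exp_nat_mul, Real.exp_log (by norm_num)]
    push_cast
    rfl
  have h := mul_meas_ge_le_integral_of_nonneg
    (Eventually.of_forall fun J => (partition_pos t J).le) hint
    (Real.exp ((Real.log 2 + t ^ 2 / 2 + ε) * n))
  rw [hE] at h
  refine le_of_mul_le_mul_left (h.trans_eq ?_)
    (Real.exp_pos ((Real.log 2 + t ^ 2 / 2 + ε) * n))
  rw [← Real.exp_add]
  ring_nf

lemma tendsto_measureReal_partition_ge (t : ℝ) {ε : ℝ} (hε : 0 < ε) :
    Tendsto (fun n : ℕ => (disorder n p).real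
      {J | Real.exp ((Real.log 2 + t ^ 2 / 2 + ε) * n) ≤ partition t J}) atTop (𝓝 0) := by
  have h := (tendsto_pow_mul_exp_neg hε 0).comp (tendsto_natCast_atTop_atTop (R := ℝ))
  simp only [pow_zero, one_mul] at h
  refine squeeze_zero' (Eventually.of_forall fun _ => measureReal_nonneg) ?_ h
  filter_upwards [eventually_gt_atTop 0] with n hn
  exact measureReal_partition_ge_le hn t ε

end Annealed

/-! ### Tilting and elementary bounds on weights -/

section Weight

variable {n p : ℕ}

lemma weight_add_weight_compl (β : ℝ) (J : Tensor n p) (A : Set (Fin n → ℝ)) :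
    weight β J A + weight β J Aᶜ = partition β J := by
  classical
  unfold weight partition
  simp only [Set.mem_compl_iff]
  convert! Finset.sum_filter_add_sum_filter_not (hypercube n) (· ∈ A)
    (fun σ => Real.exp (β * n * hamiltonian J σ))

lemma exp_le_weight (β : ℝ) (J : Tensor n p) {A : Set (Fin n → ℝ)} {σ : Fin n → ℝ}
    (hσ : σ ∈ hypercube n) (hA : σ ∈ A) : Real.exp (β * n * hamiltonian J σ) ≤ weight β J A := by
  classical
  unfold weight
  exact Finset.single_le_sum (f := fun σ => Real.exp (β * n * hamiltonian J σ))
    (fun _ _ => (Real.exp_pos _).le) (Finset.mem_filter.2 ⟨hσ, hA⟩)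

/-- Exponential tilting: above β + d, exp(βnH) ≤ exp(-d(β + d)n) exp((β + d)nH), and symmetrically
below β - d. -/
lemma weight_le_of_forall {β d : ℝ} (hd : 0 ≤ d) (J : Tensor n p) {A : Set (Fin n → ℝ)}
    (hA : ∀ σ ∈ A, hamiltonian J σ < β - d ∨ β + d < hamiltonian J σ) :
    weight β J A ≤ Real.exp (-(d * (β + d)) * n) * partition (β + d) J +
      Real.exp (d * (β - d) * n) * partition (β - d) J := by
  classical
  unfold weight partition
  rw [Finset.mul_sum, Finset.mul_sum, ← Finset.sum_add_distrib]
  refine (Finset.sum_le_sum fun σ hσ => ?_).trans (Finset.sum_le_sum_of_subset_of_nonneg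
    (Finset.filter_subset _ _) fun _ _ _ => by positivity)
  rw [← Real.exp_add, ← Real.exp_add]
  have hn : (0 : ℝ) ≤ d * n := by positivity
  rcases hA σ (Finset.mem_filter.1 hσ).2 with h | h
  · refine le_add_of_nonneg_of_le (Real.exp_pos _).le (Real.exp_le_exp.2 ?_)
    nlinarith
  · refine le_add_of_le_of_nonneg (Real.exp_le_exp.2 ?_) (Real.exp_pos _).le
    nlinarith

open Classical in
lemma card_mul_exp_le_partition {β u v : ℝ} (hβ : 0 ≤ β) (J : Tensor n p) :
    (((hypercube n).filter fun σ => hamiltonian J σ ∈ Set.Icc u v).card : ℝ) *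
      Real.exp (β * u * n) ≤ partition β J := by
  rw [← nsmul_eq_mul, ← Finset.sum_const]
  refine (Finset.sum_le_sum fun σ hσ => ?_).trans (Finset.sum_le_sum_of_subset_of_nonneg
    (Finset.filter_subset _ _) fun _ _ _ => (Real.exp_pos _).le)
  have := (Finset.mem_filter.1 hσ).2.1
  rw [mul_right_comm]
  gcongr

end Weight

/-! ### Deterministic estimates on the typical event -/

/-- If the complementary weight is an exponentially small fraction of the total, it can be written
in the two exponential forms. -/
lemma exists_exponents {Z A R c C : ℝ} {n : ℕ} (hZ : 0 < Z) (hA : A + R = Z)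
    (hlow : Real.exp (-(C * n)) * Z ≤ R) (hup : R ≤ Real.exp (-(c * n)) * Z)
    (hhalf : 2 * R ≤ Z) (hup2 : 2 * R ≤ Real.exp (-(c * n)) * Z) :
    (∃ x ∈ Set.Icc (c * n) (C * n), Z = A * (1 + Real.exp (-x))) ∧
      ∃ y ∈ Set.Icc (c * n) (C * n), A / Z = 1 - Real.exp (-y) := by
  have hR : 0 < R := lt_of_lt_of_le (by positivity) hlow
  have hApos : 0 < A := by linarith
  have hAZ : A ≤ Z := by linarith
  constructor
  -- Dividing by A instead of Z costs a factor 2, as A ≥ Z/2; hence the doubled upper bound on R.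
  · refine ⟨-Real.log (R / A), ⟨?_, ?_⟩, ?_⟩
    · rw [le_neg, Real.log_le_iff_le_exp (by positivity), div_le_iff₀ hApos]
      nlinarith [Real.exp_pos (-(c * n))]
    · rw [neg_le, Real.le_log_iff_exp_le (by positivity), le_div_iff₀ hApos]
      exact le_trans (by gcongr) hlow
    · rw [neg_neg, Real.exp_log (by positivity)]
      field_simp
      linarith
  · refine ⟨-Real.log (R / Z), ⟨?_, ?_⟩, ?_⟩
    · rwa [le_neg, Real.log_le_iff_le_exp (by positivity), div_le_iff₀ hZ]
    · rwa [neg_le, Real.le_log_iff_exp_le (by positivity), le_div_iff₀ hZ]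
    · rw [neg_neg, Real.exp_log (by positivity)]
      field_simp
      linarith

open Classical in
/-- On the typical event, the weight outside the energy band of half-width `d` around `β` lies
between exponentially small fractions of the partition function. -/
lemma exists_exponents_of_typical {n p : ℕ} {β δ d a b : ℝ} (hβ : 0 < β) (hd : 0 < d)
    (hda : d < a + β) (hδ : β * δ + δ ^ 2 / 2 < d ^ 2 / 8) (J : Tensor n p)
    {A : Set (Fin n → ℝ)}
    (hout : ∀ σ ∈ Aᶜ, hamiltonian J σ < β - d ∨ β + d < hamiltonian J σ)
    (hin : ∀ σ, hamiltonian J σ < β - d → σ ∈ Aᶜ)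
    (h1 : Real.exp ((Real.log 2 - (β + δ) ^ 2 / 2 - d ^ 2 / 8) * n) <
      (((hypercube n).filter fun σ => hamiltonian J σ ∈ Set.Icc β (β + δ)).card : ℝ))
    (h2 : 0 < ((hypercube n).filter fun σ => hamiltonian J σ ∈ Set.Icc (-b) (-a)).card)
    (h3 : partition β J < Real.exp ((Real.log 2 + β ^ 2 / 2 + 1) * n))
    (h4 : partition (β + d) J < Real.exp ((Real.log 2 + (β + d) ^ 2 / 2 + d ^ 2 / 8) * n))
    (h5 : partition (β - d) J < Real.exp ((Real.log 2 + (β - d) ^ 2 / 2 + d ^ 2 / 8) * n))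
    {c : ℝ} (hc : 0 ≤ c) (hn : 4 * Real.exp (-(d ^ 2 / 8) * n) ≤ Real.exp (-(c * n)))
    (hn' : 4 * Real.exp (-(d ^ 2 / 8) * n) ≤ 1) :
    (∃ x ∈ Set.Icc (c * n) ((c + (Real.log 2 + β ^ 2 / 2 + 1 + β * b)) * n),
        partition β J = weight β J A * (1 + Real.exp (-x))) ∧
      ∃ y ∈ Set.Icc (c * n) ((c + (Real.log 2 + β ^ 2 / 2 + 1 + β * b)) * n),
        weight β J A / partition β J = 1 - Real.exp (-y) := by
  have hZ := partition_pos β J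
  -- lower bound for the partition function
  have hZlow : Real.exp ((Real.log 2 + β ^ 2 / 2 - d ^ 2 / 4) * n) ≤ partition β J := by
    refine le_trans ?_ (card_mul_exp_le_partition (u := β) (v := β + δ) hβ.le J)
    refine le_trans ?_ (mul_le_mul_of_nonneg_right h1.le (Real.exp_pos _).le)
    rw [← Real.exp_add, ← add_mul]
    gcongr
    linear_combination hδ
  -- upper bound for the weight outside the band
  have hRup : 2 * weight β J Aᶜ ≤
      4 * Real.exp (-(d ^ 2 / 8) * n) * partition β J := by
    have h := weight_le_of_forall (β := β) hd.le J (A := Aᶜ) hout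
    -- Of the gain d²/2 from completing the square, d²/8 pays for Markov and d²/4 for the lower
    -- bound on Z_β, leaving d²/8.
    have e4 : Real.exp (-(d * (β + d)) * n) *
        Real.exp ((Real.log 2 + (β + d) ^ 2 / 2 + d ^ 2 / 8) * n) =
        Real.exp (-(d ^ 2 / 8) * n) *
          Real.exp ((Real.log 2 + β ^ 2 / 2 - d ^ 2 / 4) * n) := by
      rw [← Real.exp_add, ← Real.exp_add]; congr 1; ring
    have e5 : Real.exp (d * (β - d) * n) *
        Real.exp ((Real.log 2 + (β - d) ^ 2 / 2 + d ^ 2 / 8) * n) =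
        Real.exp (-(d ^ 2 / 8) * n) *
          Real.exp ((Real.log 2 + β ^ 2 / 2 - d ^ 2 / 4) * n) := by
      rw [← Real.exp_add, ← Real.exp_add]; congr 1; ring
    have f4 := mul_le_mul_of_nonneg_left h4.le (Real.exp_pos (-(d * (β + d)) * n)).le
    have f5 := mul_le_mul_of_nonneg_left h5.le (Real.exp_pos (d * (β - d) * n)).le
    have f := mul_le_mul_of_nonneg_left hZlow (Real.exp_pos (-(d ^ 2 / 8) * n)).le
    linarith
  -- lower bound for the weight outside the band
  have hRlow : Real.exp (-((c + (Real.log 2 + β ^ 2 / 2 + 1 + β * b)) * n)) * partition β J ≤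
      weight β J Aᶜ := by
    obtain ⟨σ, hσ⟩ := Finset.card_pos.1 h2
    obtain ⟨hσ, hσ1, hσ2⟩ := Finset.mem_filter.1 hσ
    have hσA : σ ∈ Aᶜ := hin σ (by linarith)
    refine le_trans ?_ (exp_le_weight β J hσ hσA)
    refine (mul_le_mul_of_nonneg_left h3.le (Real.exp_pos _).le).trans ?_
    rw [← Real.exp_add]
    gcongr
    have g1 := mul_le_mul_of_nonneg_left hσ1 (by positivity : (0 : ℝ) ≤ β * n)
    have g2 : (0 : ℝ) ≤ c * n := by positivity
    linarith
  have hR0 : 0 ≤ weight β J Aᶜ := le_trans (by positivity) hRlow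
  have hup2 : 2 * weight β J Aᶜ ≤ Real.exp (-(c * n)) * partition β J :=
    hRup.trans (mul_le_mul_of_nonneg_right hn hZ.le)
  have hhalf : 2 * weight β J Aᶜ ≤ partition β J :=
    hRup.trans ((mul_le_mul_of_nonneg_right hn' hZ.le).trans_eq (one_mul _))
  exact exists_exponents hZ (weight_add_weight_compl β J A) hRlow (by linarith) hhalf hup2

end PSpin

/-! ### Choice of levels and union bound -/

theorem mainTheorem6 (β κ : ℝ) (hβ : 0 < β) (hβ' : β < √(2 * Real.log 2))
    (hκ : 0 < κ) (hκ' : κ < 1 / √2) :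
    ∃ P : ℕ, ∀ p : ℕ, P ≤ p → ∃ c C : ℝ, 0 < c ∧ c ≤ C ∧
      Tendsto (fun n : ℕ => PSpin.disorder n p {J : PSpin.Tensor n p |
          (∃ x ∈ Set.Icc (c * n) (C * n),
            PSpin.partition β J =
              PSpin.restrictedPartition β J (β / √(2 * Real.log 2) - κ)
                (β / √(2 * Real.log 2) + κ) * (1 + Real.exp (-x))) ∧
          (∃ y ∈ Set.Icc (c * n) (C * n),
            PSpin.gibbs β J {σ | PSpin.hamiltonian J σ / √(2 * Real.log 2) ∈
                Set.Icc (β / √(2 * Real.log 2) - κ) (β / √(2 * Real.log 2) + κ)} =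
              1 - Real.exp (-y))})
        atTop (𝓝 1) := by
  classical
  have hlog : 0 < Real.log 2 := Real.log_pos (by norm_num)
  set w : ℝ := √(2 * Real.log 2) with hw
  have hw0 : 0 < w := Real.sqrt_pos.2 (by positivity)
  have hw2 : w ^ 2 = 2 * Real.log 2 := Real.sq_sqrt (by positivity)
  set d : ℝ := κ * w with hd
  have hd0 : 0 < d := by positivity
  -- a level below the lower edge of the band
  set a : ℝ := √(Real.log 2) with ha
  have ha0 : 0 < a := Real.sqrt_pos.2 hlog
  have hwa : w = √2 * a := Real.sqrt_mul (by norm_num) _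
  -- This is where κ < 1/√2 enters: -a < -d < β - d, while a < w keeps the level -a subcritical.
  have hda : d < a := by
    have h2 : 0 < √(2 : ℝ) := by positivity
    rw [lt_div_iff₀ h2] at hκ'
    rw [hd, hwa, ← mul_assoc]
    nlinarith
  have haw : a < w := by
    rw [hw, ha]
    exact Real.sqrt_lt_sqrt hlog.le (by linarith)
  obtain ⟨b', hab', hb'w⟩ := exists_between haw
  have hb' : b' ^ 2 / 2 < Real.log 2 := by nlinarith
  -- a level slightly above `β`
  obtain ⟨δ, hδ0, hδw, hδd⟩ : ∃ δ : ℝ, 0 < δ ∧ β + δ < w ∧ β * δ + δ ^ 2 / 2 < d ^ 2 / 8 := by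
    have h1 : Tendsto (fun δ : ℝ => β + δ) (𝓝[>] 0) (𝓝 β) :=
      ((by fun_prop : Continuous fun δ : ℝ => β + δ).tendsto' 0 β (by simp)).mono_left
        nhdsWithin_le_nhds
    have h2 : Tendsto (fun δ : ℝ => β * δ + δ ^ 2 / 2) (𝓝[>] 0) (𝓝 0) :=
      ((by fun_prop : Continuous fun δ : ℝ => β * δ + δ ^ 2 / 2).tendsto' 0 0
        (by simp)).mono_left nhdsWithin_le_nhds
    obtain ⟨δ, h, h'⟩ := ((h1.eventually_lt_const hβ').and
      (h2.eventually_lt_const (by positivity : 0 < d ^ 2 / 8))).and self_mem_nhdsWithin |>.exists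
    exact ⟨δ, h', h.1, h.2⟩
  have hb : (β + δ) ^ 2 / 2 < Real.log 2 := by nlinarith
  obtain ⟨P₁, hP₁⟩ := PSpin.exists_tendsto_card_lt (b := β + δ) (u := β) (v := β + δ) hb
    (by rw [abs_of_pos hβ]; linarith) (by rw [abs_of_pos (by linarith)]) (by linarith)
  obtain ⟨P₂, hP₂⟩ := PSpin.exists_tendsto_card_lt (b := b') (u := -b') (v := -a) hb'
    (by rw [abs_neg, abs_of_pos (by linarith)]) (by rw [abs_neg, abs_of_pos ha0]; exact hab'.le)
    (by linarith)
  refine ⟨max P₁ P₂, fun p hp => ?_⟩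
  -- Half the rate d²/8, so that the prefactor 4 is absorbed for large n.
  set c : ℝ := d ^ 2 / 16 with hc
  set C : ℝ := c + (Real.log 2 + β ^ 2 / 2 + 1 + β * b') with hC
  have hc0 : 0 < c := by positivity
  have hcC : c ≤ C := by
    have : 0 < β * b' := mul_pos hβ (by linarith)
    have := sq_nonneg β
    linarith
  refine ⟨c, C, hc0, hcC, ?_⟩
  set E : (n : ℕ) → Set (PSpin.Tensor n p) := fun n => {J |
      (∃ x ∈ Set.Icc (c * n) (C * n), PSpin.partition β J =
        PSpin.restrictedPartition β J (β / w - κ) (β / w + κ) * (1 + Real.exp (-x))) ∧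
      (∃ y ∈ Set.Icc (c * n) (C * n),
        PSpin.gibbs β J {σ | PSpin.hamiltonian J σ / w ∈ Set.Icc (β / w - κ) (β / w + κ)} =
          1 - Real.exp (-y))}
  -- the five exceptional events
  set B₁ : (n : ℕ) → Set (PSpin.Tensor n p) := fun n => {J |
      (((PSpin.hypercube n).filter fun σ => PSpin.hamiltonian J σ ∈ Set.Icc β (β + δ)).card : ℝ) ≤
        Real.exp ((Real.log 2 - (β + δ) ^ 2 / 2 - d ^ 2 / 8) * n)}
  -- Giving up the whole rate makes the threshold exp(0) = 1: only one such configuration is needed.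
  set B₂ : (n : ℕ) → Set (PSpin.Tensor n p) := fun n => {J |
      (((PSpin.hypercube n).filter fun σ => PSpin.hamiltonian J σ ∈ Set.Icc (-b') (-a)).card : ℝ) ≤
        Real.exp ((Real.log 2 - b' ^ 2 / 2 - (Real.log 2 - b' ^ 2 / 2)) * n)}
  set B : ℝ → ℝ → (n : ℕ) → Set (PSpin.Tensor n p) := fun t ε n => {J |
      Real.exp ((Real.log 2 + t ^ 2 / 2 + ε) * n) ≤ PSpin.partition t J}
  have hB₁ : Tendsto (fun n => (PSpin.disorder n p).real (B₁ n)) atTop (𝓝 0) :=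
    hP₁ p ((le_max_left _ _).trans hp) _ (by positivity)
  have hB₂ : Tendsto (fun n => (PSpin.disorder n p).real (B₂ n)) atTop (𝓝 0) :=
    hP₂ p ((le_max_right _ _).trans hp) _ (by linarith)
  have hB : ∀ t : ℝ, ∀ ε > 0, Tendsto (fun n => (PSpin.disorder n p).real (B t ε n)) atTop (𝓝 0) :=
    fun t ε hε => PSpin.tendsto_measureReal_partition_ge t hε
  have hlarge : ∀ᶠ n : ℕ in atTop, 4 * Real.exp (-(d ^ 2 / 8) * n) ≤ Real.exp (-(c * n)) ∧
      4 * Real.exp (-(d ^ 2 / 8) * n) ≤ 1 := by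
    have h := (PSpin.tendsto_pow_mul_exp_neg hc0 0).comp (tendsto_natCast_atTop_atTop (R := ℝ))
    simp only [pow_zero, one_mul] at h
    filter_upwards [h.eventually_le_const (by norm_num : (0 : ℝ) < 1 / 4)] with n hn
    simp only [Function.comp_apply] at hn
    have h1 : Real.exp (-(d ^ 2 / 8) * n) = Real.exp (-c * n) * Real.exp (-c * n) := by
      rw [← Real.exp_add]; congr 1; rw [hc]; ring
    have h2 := Real.exp_pos (-c * n)
    rw [h1, ← neg_mul]
    constructor <;> nlinarith
  -- Covering the whole space lets subadditivity bound the probability of `E n` from below without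
  -- proving `E n` measurable.
  have hsub : ∀ᶠ n : ℕ in atTop, Set.univ ⊆ E n ∪ (B₁ n ∪ B₂ n ∪ B β 1 n ∪
      B (β + d) (d ^ 2 / 8) n ∪ B (β - d) (d ^ 2 / 8) n) := by
    filter_upwards [hlarge] with n hn J _
    by_cases hJ : J ∈ B₁ n ∪ B₂ n ∪ B β 1 n ∪ B (β + d) (d ^ 2 / 8) n ∪ B (β - d) (d ^ 2 / 8) n
    · exact Or.inr hJ
    left
    simp only [Set.mem_union, not_or] at hJ
    obtain ⟨⟨⟨⟨h1, h2⟩, h3⟩, h4⟩, h5⟩ := hJ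
    simp only [B₁, B₂, B, Set.mem_ofPred_eq, not_le] at h1 h2 h3 h4 h5
    set A : Set (Fin n → ℝ) := {σ | (β / w - κ) * w ≤ PSpin.hamiltonian J σ ∧
      PSpin.hamiltonian J σ ≤ (β / w + κ) * w}
    have hlo : (β / w - κ) * w = β - d := by rw [hd]; field_simp
    have hhi : (β / w + κ) * w = β + d := by rw [hd]; field_simp
    have hband : {σ : Fin n → ℝ | PSpin.hamiltonian J σ / w ∈ Set.Icc (β / w - κ) (β / w + κ)} =
        A := by
      ext σ
      simp only [A, Set.mem_Icc, Set.mem_ofPred_eq, le_div_iff₀ hw0, div_le_iff₀ hw0]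
    have hpos : 0 < ((PSpin.hypercube n).filter
        fun σ => PSpin.hamiltonian J σ ∈ Set.Icc (-b') (-a)).card := by
      exact_mod_cast (Real.exp_pos _).trans h2
    have key := PSpin.exists_exponents_of_typical hβ hd0 (by linarith) hδd J (A := A)
      (fun σ hσ => by
        by_contra! hcon
        exact hσ ⟨hlo ▸ hcon.1, hhi ▸ hcon.2⟩)
      (fun σ h hσ => absurd (hlo ▸ hσ.1) (not_le.2 h)) h1 hpos h3 h4 h5 hc0.le hn.1 hn.2
    refine ⟨key.1, ?_⟩
    rw [PSpin.gibbs, hband]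
    exact key.2
  have hlim : Tendsto (fun n => 1 - ((PSpin.disorder n p).real (B₁ n) +
      (PSpin.disorder n p).real (B₂ n) + (PSpin.disorder n p).real (B β 1 n) +
      (PSpin.disorder n p).real (B (β + d) (d ^ 2 / 8) n) +
      (PSpin.disorder n p).real (B (β - d) (d ^ 2 / 8) n))) atTop (𝓝 1) := by
    have := (((((hB₁.add hB₂).add (hB β 1 one_pos)).add (hB (β + d) (d ^ 2 / 8) (by positivity))).add
      (hB (β - d) (d ^ 2 / 8) (by positivity))).const_sub 1)
    simpa using this
  have hreal : Tendsto (fun n => (PSpin.disorder n p).real (E n)) atTop (𝓝 1) := by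
    refine tendsto_of_tendsto_of_tendsto_of_le_of_le' hlim tendsto_const_nhds ?_
      (Eventually.of_forall fun n => measureReal_le_one)
    filter_upwards [hsub] with n hn
    have h1 := measureReal_mono (μ := PSpin.disorder n p) hn
    rw [probReal_univ] at h1
    have u1 := measureReal_union_le (μ := PSpin.disorder n p) (E n) (B₁ n ∪ B₂ n ∪ B β 1 n ∪
      B (β + d) (d ^ 2 / 8) n ∪ B (β - d) (d ^ 2 / 8) n)
    have u2 := measureReal_union_le (μ := PSpin.disorder n p) (B₁ n ∪ B₂ n ∪ B β 1 n ∪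
      B (β + d) (d ^ 2 / 8) n) (B (β - d) (d ^ 2 / 8) n)
    have u3 := measureReal_union_le (μ := PSpin.disorder n p) (B₁ n ∪ B₂ n ∪ B β 1 n)
      (B (β + d) (d ^ 2 / 8) n)
    have u4 := measureReal_union_le (μ := PSpin.disorder n p) (B₁ n ∪ B₂ n) (B β 1 n)
    have u5 := measureReal_union_le (μ := PSpin.disorder n p) (B₁ n) (B₂ n)
    linarith
  have := (ENNReal.continuous_ofReal.tendsto 1).comp hreal
  rw [ENNReal.ofReal_one] at this
  exact this.congr fun n => ofReal_measureReal
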